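/- \textbf{Theorem (convergence of signed categorical TD learning).} Consider a Markov decision process with finite state space $\mathcal X$, measurable action space $\mathcal A$, transition kernel $P(\cdot\mid x,a)$, reward function $r:\mathcal X\to\mathbb R^d$, discount factor $\gamma\in[0,1)$, and a policy $\pi(\cdot\mid x)$; write $P^\pi(\cdot\mid x)=\int P(\cdot\mid x,a)\,\pi(\mathrm da\mid x)$ and $b_{y}(z)=y+\gamma z$. \emph{Kernel.} Let $\rho:\mathbb R^d\times\mathbb R^d\to[0,\infty)$ be a semimetric (symmetric, with $\rho(y_1,y_2)=0$ iff $y_1=y_2$) of strong negative type, i.e. $\int\rho\,\mathrm d([p-q]\times[p-q])$ exists and is $<0$ for all distinct probability measures $p,q$ carried by a common compact set. Assume that $\rho$ is shift-invariant, $\rho(z+y_1,z+y_2)=\rho(y_1,y_2)$, and homogeneous: for every $g\in[0,1)$ there is $c>0$ with $\rho(gy_1,gy_2)=g^{c}\rho(y_1,y_2)$ for all $y_1,y_2$. Fix $y_0\in\mathbb R^d$ and let $\kappa(y_1,y_2)=\tfrac12(\rho(y_1,y_0)+\rho(y_2,y_0)-\rho(y_1,y_2))$. For signed measures put $\mathrm{MMD}_\kappa(p,q)^2=\iint\kappa\,\mathrm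 dp\,\mathrm dp-2\iint\kappa\,\mathrm dp\,\mathrm dq+\iint\kappa\,\mathrm dq\,\mathrm dq$, and $\overline{\mathrm{MMD}}_\kappa(\eta_1,\eta_2)=\sup_{x}\mathrm{MMD}_\kappa(\eta_1(x),\eta_2(x))$. \emph{Projection and Bellman operator.} For a set $S$ let $\mathcal M^1(S)$ be the signed measures of total mass $1$ carried by $S$. For each $x$ let $C(x)\subset\mathbb R^d$ be a nonempty finite set, let $\mathcal S=\prod_{x\in\mathcal X}\mathcal M^1(C(x))$, and $$(\Pi^{\mathrm{SC}}\eta)(x)=\operatorname*{arg\,min}_{p\in\mathcal M^1(C(x))}\mathrm{MMD}_\kappa(p,\eta(x)),\qquad (\mathcal T^\pi\eta)(x)=\mathbb E_{X'\sim P^\pi(\cdot\mid x)}\big[(b_{r(x)})_{\#}\eta(X')\big].$$ \emph{Data and iterates.} Let $T_t=(X_t,A_t,R_t,X'_t)$, $t\ge0$, be random transitions such that, with $\mathcal G_t=\sigma(T_0,\dots,T_{t-1},X_t)$: the conditional law of $X_t$ given $T_0,\dots,T_{t-1}$ is arbitrary; $A_t\sim\pi(\cdot\mid X_t)$ conditionally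 on $\mathcal G_t$; $R_t=r(X_t)$; and $X'_t\sim P(\cdot\mid X_t,A_t)$ conditionally on $\sigma(\mathcal G_t,A_t)$. Let $\alpha_t\ge0$ be (possibly random) step sizes such that $\alpha_t$ is $\mathcal G_t$-measurable, and with probability $1$, for every $x\in\mathcal X$, $$\sum_{t}\alpha_t\mathbf 1\{X_t=x\}=\infty,\qquad \sum_t\alpha_t^2\mathbf 1\{X_t=x\}<\infty .$$ Let $(\widehat{\mathcal T}_t\eta)(x)=(b_{R_t})_\#\eta(X'_t)$ if $x=X_t$ and $(\widehat{\mathcal T}_t\eta)(x)=\eta(x)$ otherwise. Given $\hat\eta_0\in\mathcal S$, let $$\hat\eta_{t+1}=(1-\alpha_t)\hat\eta_t+\alpha_t\Pi^{\mathrm{SC}}\widehat{\mathcal T}_t\hat\eta_t .$$ \emph{Conclusion.} The minimiser defining $\Pi^{\mathrm{SC}}$ exists and is unique for every finitely supported signed measure of mass $1$; the operator $\Pi^{\mathrm{SC}}\mathcal T^\pi$ has a unique fixed point $\eta^\pi_{\mathrm{SC}}$ in $\mathcal S$; and, with probability $1$, $\overline{\mathrm{MMD}}_\kappa(\hat\eta_t,\eta^\pi_{\mathrm{SC}})\to0$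 as $t\to\infty$. -/

import Mathlib

open MeasureTheory ProbabilityTheory Filter Topology
open scoped ENNReal

namespace CatTD

/-! ### Semimetrics and induced kernels -/

/-- A semimetric: nonnegative, symmetric, and zero exactly on the diagonal
(no triangle inequality). -/
structure IsSemimetric {Y : Type*} (ρ : Y → Y → ℝ) : Prop where
  nonneg : ∀ y₁ y₂, 0 ≤ ρ y₁ y₂
  symm : ∀ y₁ y₂, ρ y₁ y₂ = ρ y₂ y₁
  eq_zero_iff : ∀ y₁ y₂, ρ y₁ y₂ = 0 ↔ y₁ = y₂

/-- Strong negative type: for any two distinct probability measures `p ≠ q` carried by a common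
compact set, `∫ ρ d([p - q] × [p - q])` exists and is negative. The integral against
`[p - q] × [p - q]` is expanded into its four parts. -/
def StrongNegativeType {Y : Type*} [TopologicalSpace Y] [MeasurableSpace Y]
    (ρ : Y → Y → ℝ) : Prop :=
  ∀ (K : Set Y) (p q : Measure Y) [IsProbabilityMeasure p] [IsProbabilityMeasure q],
    IsCompact K → p Kᶜ = 0 → q Kᶜ = 0 → p ≠ q →
      Integrable (Function.uncurry ρ) (p.prod p) ∧
      Integrable (Function.uncurry ρ) (p.prod q) ∧
      Integrable (Function.uncurry ρ) (q.prod p) ∧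
      Integrable (Function.uncurry ρ) (q.prod q) ∧
      (∫ z, Function.uncurry ρ z ∂(p.prod p)) - (∫ z, Function.uncurry ρ z ∂(p.prod q))
        - (∫ z, Function.uncurry ρ z ∂(q.prod p)) + (∫ z, Function.uncurry ρ z ∂(q.prod q)) < 0

/-- Shift-invariance of a function of two vectors. -/
def ShiftInvariant {Y : Type*} [Add Y] (ρ : Y → Y → ℝ) : Prop :=
  ∀ z y₁ y₂, ρ (z + y₁) (z + y₂) = ρ y₁ y₂

/-- Homogeneity of a function of two vectors: for every `g ∈ [0,1)` there is an exponent `c > 0`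
with `ρ (g y₁) (g y₂) = g ^ c ρ y₁ y₂` for all `y₁, y₂`. -/
def Homogeneous {Y : Type*} [SMul ℝ Y] (ρ : Y → Y → ℝ) : Prop :=
  ∀ g : ℝ, 0 ≤ g → g < 1 → ∃ c : ℝ, 0 < c ∧ ∀ y₁ y₂, ρ (g • y₁) (g • y₂) = g ^ c * ρ y₁ y₂

/-- The kernel induced by `ρ` with base point `y₀`. -/
noncomputable def inducedKernel {Y : Type*} (ρ : Y → Y → ℝ) (y₀ : Y) (y₁ y₂ : Y) : ℝ :=
  (1 / 2) * (ρ y₁ y₀ + ρ y₂ y₀ - ρ y₁ y₂)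

/-! ### Signed measures, maximum mean discrepancy, signed categorical projection -/

/-- The signed measures of total mass one that are carried by the set `S`. -/
def massOne {Y : Type*} [MeasurableSpace Y] (S : Set Y) : Set (SignedMeasure Y) :=
  {p | p Set.univ = 1 ∧ ∀ B, MeasurableSet B → Disjoint B S → p B = 0}

/-- `∫∫ κ(y, z) p(dy) q(dz)`, which is the inner product of the mean embeddings of `p` and `q`. -/
noncomputable def kernelPairing {Y : Type*} [MeasurableSpace Y] (κ : Y → Y → ℝ)
    (p q : SignedMeasure Y) : ℝ :=
  ∫ᵛ z, (∫ᵛ y, κ y z ∂•p) ∂•q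

/-- The maximum mean discrepancy: the norm of the difference of the mean embeddings of `p`, `q`. -/
noncomputable def mmd {Y : Type*} [MeasurableSpace Y] (κ : Y → Y → ℝ)
    (p q : SignedMeasure Y) : ℝ :=
  Real.sqrt (kernelPairing κ p p - 2 * kernelPairing κ p q + kernelPairing κ q q)

/-- The supremal maximum mean discrepancy of two state-indexed signed measures. -/
noncomputable def supMMD {X Y : Type*} [MeasurableSpace Y] (κ : Y → Y → ℝ)
    (η₁ η₂ : X → SignedMeasure Y) : ℝ :=
  ⨆ x, mmd κ (η₁ x) (η₂ x)

/-- `p` minimises the maximum mean discrepancy to `q` over the mass-one signed measures on `S`. -/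
def IsSignedProj {Y : Type*} [MeasurableSpace Y] (κ : Y → Y → ℝ) (S : Set Y)
    (q p : SignedMeasure Y) : Prop :=
  p ∈ massOne S ∧ ∀ p' ∈ massOne S, mmd κ p q ≤ mmd κ p' q

/-- The signed categorical projection, at a single state with support `S`, as a choice of minimiser
(arbitrary if there is none). -/
noncomputable def signedProj {Y : Type*} [MeasurableSpace Y] (κ : Y → Y → ℝ) (S : Set Y)
    (q : SignedMeasure Y) : SignedMeasure Y :=
  Classical.epsilon (IsSignedProj κ S q)

/-- The signed categorical projection with support map `C`, acting state by state. -/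
noncomputable def signedCatProj {X Y : Type*} [MeasurableSpace Y] (κ : Y → Y → ℝ)
    (C : X → Finset Y) (η : X → SignedMeasure Y) : X → SignedMeasure Y :=
  fun x => signedProj κ (C x : Set Y) (η x)

/-- The state-indexed mass-one signed measures with `η x` carried by `C x`. -/
def signedCatClass {X Y : Type*} [MeasurableSpace Y] (C : X → Finset Y) :
    Set (X → SignedMeasure Y) :=
  {η | ∀ x, η x ∈ massOne (C x : Set Y)}

/-! ### Distributional Bellman operators -/

/-- The map `z ↦ y + γ z`. -/
def boot {E : Type*} [Add E] [SMul ℝ E] (γ : ℝ) (y z : E) : E := y + γ • z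

/-- The transition kernel under the policy: `P^π(· | x) = ∫ P(· | x, a) π(da | x)`. -/
noncomputable def policyKernel {X A : Type*} [MeasurableSpace X] [MeasurableSpace A]
    (π : Kernel X A) (P : Kernel (X × A) X) : Kernel X X :=
  (π ⊗ₖ P).snd

/-- The distributional Bellman operator on a finite state space:
`(T η)(x) = E_{X' ∼ P^π(· | x)} [(z ↦ r x + γ z)_# η(X')]`. -/
noncomputable def bellman {X A E : Type*} [Fintype X] [MeasurableSpace X] [MeasurableSpace A]
    [Add E] [SMul ℝ E] [MeasurableSpace E] (π : Kernel X A) (P : Kernel (X × A) X)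
    (r : X → E) (γ : ℝ) (η : X → SignedMeasure E) : X → SignedMeasure E :=
  fun x => ∑ x' : X, (policyKernel π P x).real {x'} • (η x').map (boot γ (r x))

open Classical in
/-- The stochastic Bellman backup from a sampled transition `(x₀, R, x')`: it backs up state `x₀`
and leaves all other states unchanged. -/
noncomputable def stochBellman {X E : Type*} [Add E] [SMul ℝ E] [MeasurableSpace E]
    (γ : ℝ) (x₀ : X) (R : E) (x' : X) (η : X → SignedMeasure E) : X → SignedMeasure E :=
  fun x => if x = x₀ then (η x').map (boot γ R) else η x

/-- The categorical TD iterates along one realisation of step sizes `α`, states `Xs`, rewards `R`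
and next states `X'`. -/
noncomputable def tdIterates {X E : Type*} [Add E] [SMul ℝ E] [MeasurableSpace E]
    (κ : E → E → ℝ) (C : X → Finset E) (γ : ℝ) (η₀ : X → SignedMeasure E)
    (α : ℕ → ℝ) (Xs : ℕ → X) (R : ℕ → E) (X' : ℕ → X) : ℕ → X → SignedMeasure E
  | 0 => η₀
  | t + 1 =>
    (1 - α t) • tdIterates κ C γ η₀ α Xs R X' t +
      α t • signedCatProj κ C
        (stochBellman γ (Xs t) (R t) (X' t) (tdIterates κ C γ η₀ α Xs R X' t))

/-! ### The stream of transitions -/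

/-- The σ-algebra generated by the transitions `(X_s, A_s, R_s, X'_s)` with `s < t` and by the
current state `X_t`. -/
abbrev preHistory {Ω X A E : Type*} [MeasurableSpace X] [MeasurableSpace A] [MeasurableSpace E]
    (Xs : ℕ → Ω → X) (As : ℕ → Ω → A) (R : ℕ → Ω → E) (X' : ℕ → Ω → X) (t : ℕ) :
    MeasurableSpace Ω :=
  (⨆ s : ℕ, ⨆ _ : s < t,
      MeasurableSpace.comap (fun ω => (Xs s ω, As s ω, R s ω, X' s ω)) inferInstance) ⊔
    MeasurableSpace.comap (Xs t) inferInstance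

/-- The generative model of the transitions `(X_t, A_t, R_t, X'_t)`: the law of `X_t` given the past
transitions is unrestricted; given the past transitions and `X_t`, the action `A_t` has law
`π(· | X_t)`; `R_t = r(X_t)`; given also `A_t`, the next state `X'_t` has law `P(· | X_t, A_t)`. -/
structure IsTransitionStream {Ω X A E : Type*} [MeasurableSpace Ω] [MeasurableSpace X]
    [MeasurableSpace A] [MeasurableSpace E] (μ : Measure Ω) (π : Kernel X A)
    (P : Kernel (X × A) X) (r : X → E)
    (Xs : ℕ → Ω → X) (As : ℕ → Ω → A) (R : ℕ → Ω → E) (X' : ℕ → Ω → X) : Prop where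
  measurable_state : ∀ t, Measurable (Xs t)
  measurable_action : ∀ t, Measurable (As t)
  measurable_next : ∀ t, Measurable (X' t)
  reward_eq : ∀ t ω, R t ω = r (Xs t ω)
  action_law : ∀ t, ∀ B : Set A, MeasurableSet B →
    μ[(As t ⁻¹' B).indicator (fun _ => (1 : ℝ)) | preHistory Xs As R X' t]
      =ᵐ[μ] fun ω => (π (Xs t ω)).real B
  next_law : ∀ t, ∀ B : Set X, MeasurableSet B →
    μ[(X' t ⁻¹' B).indicator (fun _ => (1 : ℝ)) |
        preHistory Xs As R X' t ⊔ MeasurableSpace.comap (As t) inferInstance]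
      =ᵐ[μ] fun ω => (P (Xs t ω, As t ω)).real B

/-- The Robbins–Monro conditions at every state along one realisation: the step sizes used at `x`
have infinite sum and finite sum of squares. -/
def RobbinsMonro {X : Type*} (α : ℕ → ℝ) (Xs : ℕ → X) : Prop :=
  ∀ x, Tendsto (fun n => ∑ t ∈ Finset.range n, {s | Xs s = x}.indicator α t) atTop atTop ∧
    Summable (fun t => {s | Xs s = x}.indicator (fun s => α s ^ 2) t)

end CatTD

open CatTD

/-! Every signed measure that occurs has finitely many atoms, so the problem is transferred by
`atomic` to finitely supported functions. Strong negative type makes `bilin ρ` negative definite on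
functions of mass zero, hence `-(1/2) * bilin ρ` is an inner product there. Shifting a function by
its mass at `y₀` gives a linear mean embedding `Φ` with Gram form the induced kernel, injective on
mass zero, and the MMD becomes the norm `‖Φ (c - c')‖`.

In this geometry the signed categorical projection is the nearest-point map onto a
finite-dimensional affine space. It is affine, and its linear part is an orthogonal projection,
hence nonexpansive. Shift-invariance and homogeneity make a Bellman backup multiply the norm of
every mass-zero function by exactly `√(γ ^ k) < 1`. The projected Bellman operator therefore
contracts the supremum norm. Its fixed point comes from linear algebra: identity minus a contraction
is injective, hence bijective, in finite dimension.

For the learning dynamics, compare the sampled projected backup of the iterate with the same sampled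
backup of the fixed point. Their difference is contractive along each path. What remains of the
error is a vector depending only on the visited state and on `X'_t`, not on the iterate, with mean
zero under the policy kernel because affine maps commute with averages. The noise thus reduces to
finitely many scalar sums of step sizes times centred transition indicators, which converge almost
surely as martingale transforms (`ae_exists_tendsto_sum_of_summable_sq`), without any prior bound on
the iterates. Subtracting the vanishing noise remainder leaves the deterministic recursion of
`tendsto_zero_of_contractive_recursion`. -/

namespace CatTD

/-! ### Finitely supported signed measures -/

section FinitelySupported

variable {Y : Type*}

/-- The total mass of a finitely supported function. -/
noncomputable def mass : (Y →₀ ℝ) →ₗ[ℝ] ℝ := Finsupp.linearCombination ℝ fun _ => (1 : ℝ)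

/-- The bilinear form on finitely supported functions with matrix `κ`. -/
noncomputable def bilin (κ : Y → Y → ℝ) : (Y →₀ ℝ) →ₗ[ℝ] (Y →₀ ℝ) →ₗ[ℝ] ℝ :=
  Finsupp.linearCombination ℝ fun y => Finsupp.linearCombination ℝ (κ y)

@[simp] lemma mass_single (y : Y) (a : ℝ) : mass (Finsupp.single y a) = a := by simp [mass]

lemma mass_eq_sum (c : Y →₀ ℝ) : mass c = ∑ y ∈ c.support, c y := by
  simp [mass, Finsupp.linearCombination_apply, Finsupp.sum]

lemma mass_mapDomain {Z : Type*} (b : Y → Z) (c : Y →₀ ℝ) :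
    mass (c.mapDomain b) = mass c := by
  simp [mass, Finsupp.linearCombination_mapDomain, Function.comp_def]

@[simp] lemma bilin_single (κ : Y → Y → ℝ) (y z : Y) (a b : ℝ) :
    bilin κ (Finsupp.single y a) (Finsupp.single z b) = a * (b * κ y z) := by
  simp [bilin]

lemma bilin_eq_sum (κ : Y → Y → ℝ) (c c' : Y →₀ ℝ) :
    bilin κ c c' = ∑ y ∈ c.support, c y * ∑ z ∈ c'.support, c' z * κ y z := by
  simp [bilin, Finsupp.linearCombination_apply, Finsupp.sum, LinearMap.sum_apply]

lemma bilin_symm {κ : Y → Y → ℝ} (h : ∀ y z, κ y z = κ z y) (c c' : Y →₀ ℝ) :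
    bilin κ c c' = bilin κ c' c := by
  have : bilin κ = (bilin κ).flip := by
    ext y z
    simp [h y z]
  conv_lhs => rw [this]
  rfl

variable [MeasurableSpace Y]

/-- The signed measure with finitely many atoms given by a finitely supported function. -/
noncomputable def atomic : (Y →₀ ℝ) →ₗ[ℝ] SignedMeasure Y :=
  Finsupp.linearCombination ℝ fun y => VectorMeasure.dirac y (1 : ℝ)

lemma atomic_eq_sum (c : Y →₀ ℝ) :
    atomic c = ∑ y ∈ c.support, c y • VectorMeasure.dirac y (1 : ℝ) := by
  simp [atomic, Finsupp.linearCombination_apply, Finsupp.sum]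

open Classical in
lemma atomic_apply (c : Y →₀ ℝ) {B : Set Y} (hB : MeasurableSet B) :
    atomic c B = ∑ y ∈ c.support, if y ∈ B then c y else 0 := by
  rw [atomic_eq_sum]
  have h : ∀ s : Finset Y, (∑ y ∈ s, c y • VectorMeasure.dirac y (1 : ℝ) : SignedMeasure Y) B
      = ∑ y ∈ s, if y ∈ B then c y else 0 := by
    intro s
    induction s using Finset.induction_on with
    | empty => simp
    | insert a s ha ih =>
      rw [Finset.sum_insert ha, Finset.sum_insert ha, add_apply, ih,
        smul_apply]
      by_cases h : a ∈ B <;> simp [h, hB]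
  exact h _

lemma atomic_univ (c : Y →₀ ℝ) : atomic c Set.univ = mass c := by
  classical
  simp [atomic_apply, mass_eq_sum]

lemma atomic_map (c : Y →₀ ℝ) {b : Y → Y} (hb : Measurable b) :
    (atomic c).map b = atomic (c.mapDomain b) := by
  have hd : ∀ y, (VectorMeasure.dirac y (1 : ℝ)).map b = VectorMeasure.dirac (b y) (1 : ℝ) := by
    intro y
    ext s hs
    rw [VectorMeasure.map_apply _ hb hs]
    by_cases h : b y ∈ s
    · rw [VectorMeasure.dirac_apply_of_mem hs h, VectorMeasure.dirac_apply_of_mem (hb hs) h]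
    · rw [VectorMeasure.dirac_apply_of_notMem h, VectorMeasure.dirac_apply_of_notMem (by exact h)]
  have h : VectorMeasure.mapₗ (R := ℝ) b ∘ₗ atomic
      = atomic ∘ₗ Finsupp.lmapDomain ℝ ℝ b := by
    ext1 y
    ext1
    simp [atomic, hd]
  exact congrArg (fun f => f c) h

variable [MeasurableSingletonClass Y]

lemma atomic_singleton (c : Y →₀ ℝ) (y : Y) : atomic c {y} = c y := by
  classical
  rw [atomic_apply c (measurableSet_singleton y)]
  simp only [Set.mem_singleton_iff, Finset.sum_ite_eq', Finsupp.mem_support_iff]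
  split_ifs with h
  · rfl
  · simpa using (not_not.1 h).symm

lemma atomic_injective : Function.Injective (atomic (Y := Y)) := by
  intro c c' h
  ext y
  rw [← atomic_singleton, h, atomic_singleton]

/-- Finitely supported functions of mass one with support in `F`. -/
def massOneFinsupp (F : Finset Y) : Set (Y →₀ ℝ) := {c | c.support ⊆ F ∧ mass c = 1}

lemma atomic_mem_massOne_iff (c : Y →₀ ℝ) (F : Finset Y) :
    atomic c ∈ massOne (F : Set Y) ↔ c ∈ massOneFinsupp F := by
  classical
  constructor
  · rintro ⟨h1, h2⟩
    refine ⟨fun y hy => ?_, by rw [← atomic_univ, h1]⟩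
    by_contra hyF
    have := h2 {y} (measurableSet_singleton y) (by simpa using hyF)
    rw [atomic_singleton] at this
    exact (Finsupp.mem_support_iff.1 hy) this
  · rintro ⟨h1, h2⟩
    refine ⟨by rw [atomic_univ, h2], fun B hB hBF => ?_⟩
    rw [atomic_apply c hB]
    refine Finset.sum_eq_zero fun y hy => if_neg fun hyB => ?_
    exact Set.disjoint_left.1 hBF hyB (h1 hy)

/-- The coefficients are the masses of the singletons in `F`; the part of a measurable set outside
`F` is null by the definition of `massOne`. -/
lemma exists_atomic_eq {F : Finset Y} {p : SignedMeasure Y} (hp : p ∈ massOne (F : Set Y)) :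
    ∃ c ∈ massOneFinsupp F, atomic c = p := by
  classical
  suffices h : ∃ c : Y →₀ ℝ, atomic c = p by
    obtain ⟨c, rfl⟩ := h
    exact ⟨c, (atomic_mem_massOne_iff c F).1 hp, rfl⟩
  have hFm : MeasurableSet (F : Set Y) := F.measurableSet
  have hs : ∀ s : Finset Y, p s = ∑ y ∈ s, p {y} := by
    intro s
    induction s using Finset.induction_on with
    | empty => simp
    | insert a s ha ih =>
      rw [Finset.sum_insert ha, Finset.coe_insert, Set.insert_eq,
        VectorMeasure.of_union (by simpa using ha) (measurableSet_singleton a) s.measurableSet, ih]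
  refine ⟨∑ y ∈ F, Finsupp.single y (p {y}), ?_⟩
  ext B hB
  have hc : ∀ y, (∑ y ∈ F, Finsupp.single y (p {y})) y = if y ∈ F then p {y} else 0 := by
    intro y
    simp [Finsupp.finsetSum_apply, Finsupp.single_apply]
  have hsub : (∑ y ∈ F, Finsupp.single y (p {y})).support ⊆ F := by
    intro y hy
    rw [Finsupp.mem_support_iff, hc] at hy
    by_contra h
    exact hy (if_neg h)
  rw [atomic_apply _ hB, Finset.sum_subset hsub]
  · have h1 : p B = p (↑(F.filter (· ∈ B)) : Set Y) := by
      have : B = (↑(F.filter (· ∈ B)) : Set Y) ∪ (B \ F) := by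
        ext y; simp; tauto
      conv_lhs => rw [this]
      rw [VectorMeasure.of_union _ (Finset.measurableSet _) (hB.diff hFm),
        hp.2 (B \ F) (hB.diff hFm) Set.disjoint_sdiff_left, add_zero]
      refine Set.disjoint_left.2 fun y hy hy' => hy'.2 ?_
      simp only [Finset.coe_filter, Set.mem_ofPred_eq] at hy
      exact hy.1
    rw [h1, hs, Finset.sum_filter]
    refine Finset.sum_congr rfl fun y hy => ?_
    rw [hc, if_pos hy]
  · intro y _ hy
    rw [Finsupp.notMem_support_iff.1 hy, ite_self]

lemma integral_atomic (f : Y → ℝ) (c : Y →₀ ℝ) :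
    ∫ᵛ y, f y ∂•(atomic c) = ∑ y ∈ c.support, c y * f y := by
  rw [atomic_eq_sum, VectorMeasure.integral_finsetSum_vectorMeasure]
  · refine Finset.sum_congr rfl fun y _ => ?_
    rw [VectorMeasure.integral_smul_vectorMeasure, VectorMeasure.integral_dirac]
    simp
  · intro y _
    refine VectorMeasure.Integrable.smul_vectorMeasure ?_ _
    simp only [VectorMeasure.Integrable, VectorMeasure.variation_dirac]
    exact (integrable_dirac (by simp)).smul_measure (by simp)

lemma kernelPairing_atomic (κ : Y → Y → ℝ) (c c' : Y →₀ ℝ) :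
    kernelPairing κ (atomic c) (atomic c') = bilin κ c c' := by
  rw [kernelPairing, integral_atomic]
  simp_rw [integral_atomic]
  rw [bilin_eq_sum]
  simp_rw [Finset.mul_sum]
  rw [Finset.sum_comm]
  exact Finset.sum_congr rfl fun _ _ => Finset.sum_congr rfl fun _ _ => by ring

end FinitelySupported

/-! ### Negative type and the mean embedding -/

section Embedding

variable {Y : Type*} [MeasurableSpace Y]

/-- The positive measure with atoms of masses `w y`, `y ∈ s`. -/
noncomputable def weighted (s : Finset Y) (w : Y → ℝ) : Measure Y :=
  ∑ y ∈ s, ENNReal.ofReal (w y) • Measure.dirac y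

lemma weighted_apply_univ (s : Finset Y) {w : Y → ℝ} (hw : ∀ y, 0 ≤ w y) :
    weighted s w Set.univ = ENNReal.ofReal (∑ y ∈ s, w y) := by
  rw [ENNReal.ofReal_sum_of_nonneg fun y _ => hw y]
  simp [weighted]

variable [MeasurableSingletonClass Y]

lemma weighted_compl (s : Finset Y) (w : Y → ℝ) : weighted s w (s : Set Y)ᶜ = 0 := by
  simp only [weighted, Measure.coe_finsetSum, Finset.sum_apply, Measure.smul_apply, smul_eq_mul]
  refine Finset.sum_eq_zero fun y hy => ?_
  rw [Measure.dirac_apply' _ s.measurableSet.compl]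
  simp [hy]

lemma weighted_singleton (s : Finset Y) (w : Y → ℝ) {y : Y} (hy : y ∈ s) :
    weighted s w {y} = ENNReal.ofReal (w y) := by
  classical
  simp [weighted, Set.indicator_apply, hy]

lemma integral_weighted (s : Finset Y) {w : Y → ℝ} (hw : ∀ y, 0 ≤ w y) (f : Y → ℝ) :
    ∫ y, f y ∂(weighted s w) = ∑ y ∈ s, w y * f y := by
  rw [weighted, integral_finsetSum_measure]
  · simp [integral_smul_measure, ENNReal.toReal_ofReal (hw _)]
  · intro y _
    exact (integrable_dirac (by simp)).smul_measure (by simp)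

/-- A semimetric of strong negative type is negative definite on finitely supported functions of
mass zero. -/
lemma bilin_neg_of_strongNegativeType [TopologicalSpace Y] {ρ : Y → Y → ℝ}
    (hneg : StrongNegativeType ρ) {c : Y →₀ ℝ} (hc : mass c = 0) (hc0 : c ≠ 0) :
    bilin ρ c c < 0 := by
  set s := c.support with hs
  set m := ∑ y ∈ s, max (c y) 0 with hm
  -- Since `c` has mass zero, its positive and negative parts have the same mass `m`; divided by `m`
  -- they become two distinct probability measures on a finite, hence compact, set.
  have hsum : ∑ y ∈ s, max (-c y) 0 = m := by
    have h : ∑ y ∈ s, (max (c y) 0 - max (-c y) 0) = 0 := by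
      rw [mass_eq_sum] at hc
      exact (Finset.sum_congr rfl fun y _ => max_zero_sub_max_neg_zero_eq_self (c y)).trans hc
    rw [Finset.sum_sub_distrib] at h
    linarith
  obtain ⟨y₁, hy₁⟩ : s.Nonempty := by simpa [hs] using hc0
  have hmpos : 0 < m := by
    rcases (Finsupp.mem_support_iff.1 hy₁).lt_or_gt with h | h
    · rw [← hsum]
      exact Finset.sum_pos' (fun y _ => le_max_right _ _) ⟨y₁, hy₁, by simpa using h⟩
    · exact Finset.sum_pos' (fun y _ => le_max_right _ _) ⟨y₁, hy₁, by simpa using h⟩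
  set u : Y → ℝ := fun y => max (c y) 0 / m with hu
  set v : Y → ℝ := fun y => max (-c y) 0 / m with hv
  have hu0 : ∀ y, 0 ≤ u y := fun y => div_nonneg (le_max_right _ _) hmpos.le
  have hv0 : ∀ y, 0 ≤ v y := fun y => div_nonneg (le_max_right _ _) hmpos.le
  have huv : ∀ y, u y - v y = c y / m := fun y => by
    rw [hu, hv, ← sub_div, max_zero_sub_max_neg_zero_eq_self]
  have hpu : IsProbabilityMeasure (weighted s u) := ⟨by
    rw [weighted_apply_univ s hu0, ← Finset.sum_div, ← hm, div_self hmpos.ne', ENNReal.ofReal_one]⟩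
  have hpv : IsProbabilityMeasure (weighted s v) := ⟨by
    rw [weighted_apply_univ s hv0, ← Finset.sum_div, hsum, div_self hmpos.ne', ENNReal.ofReal_one]⟩
  have hne : weighted s u ≠ weighted s v := by
    intro h
    have h1 : weighted s u {y₁} = weighted s v {y₁} := by rw [h]
    rw [weighted_singleton s u hy₁, weighted_singleton s v hy₁,
      ENNReal.ofReal_eq_ofReal_iff (hu0 _) (hv0 _)] at h1
    have h2 := huv y₁
    rw [h1, sub_self, eq_comm, div_eq_zero_iff] at h2
    exact h2.elim (Finsupp.mem_support_iff.1 hy₁) hmpos.ne'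
  obtain ⟨i1, i2, i3, i4, hlt⟩ := hneg (s : Set Y) (weighted s u) (weighted s v)
    s.finite_toSet.isCompact (weighted_compl s u) (weighted_compl s v) hne
  rw [integral_prod _ i1, integral_prod _ i2, integral_prod _ i3, integral_prod _ i4] at hlt
  simp only [Function.uncurry_apply_pair, integral_weighted s hu0, integral_weighted s hv0] at hlt
  have key : bilin ρ c c = m ^ 2 * (∑ y ∈ s, u y * ∑ z ∈ s, u z * ρ y z
      - ∑ y ∈ s, u y * ∑ z ∈ s, v z * ρ y z - ∑ y ∈ s, v y * ∑ z ∈ s, u z * ρ y z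
      + ∑ y ∈ s, v y * ∑ z ∈ s, v z * ρ y z) := by
    rw [bilin_eq_sum, ← hs]
    simp_rw [Finset.mul_sum, ← Finset.sum_sub_distrib, ← Finset.sum_add_distrib, Finset.mul_sum]
    refine Finset.sum_congr rfl fun y _ => Finset.sum_congr rfl fun z _ => ?_
    have h1 : c y = m * (u y - v y) := by rw [huv]; field_simp
    have h2 : c z = m * (u z - v z) := by rw [huv]; field_simp
    rw [h1, h2]
    ring
  rw [key]
  exact mul_neg_of_pos_of_neg (by positivity) hlt

/-- The base point only recentres: removing the mass of each argument at `y₀` turns the kernel form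
into `ρ` restricted to mass zero. By bilinearity it suffices to check point masses. -/
lemma bilin_inducedKernel {Y : Type*} {ρ : Y → Y → ℝ} (h0 : ∀ y, ρ y y = 0)
    (hs : ∀ y z, ρ y z = ρ z y) (y₀ : Y) (c c' : Y →₀ ℝ) :
    bilin (inducedKernel ρ y₀) c c' = -(1 / 2) * bilin ρ (c - Finsupp.single y₀ (mass c))
      (c' - Finsupp.single y₀ (mass c')) := by
  let δ : (Y →₀ ℝ) →ₗ[ℝ] (Y →₀ ℝ) := LinearMap.id - Finsupp.lsingle y₀ ∘ₗ mass
  have h : bilin (inducedKernel ρ y₀) = (-(1 / 2) : ℝ) • (bilin ρ).compl₁₂ δ δ := by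
    ext y z
    simp [δ, inducedKernel, h0, hs y₀ z]
    ring
  rw [h]
  rfl

lemma bilin_inducedKernel_of_mass_zero {Y : Type*} {ρ : Y → Y → ℝ} (h0 : ∀ y, ρ y y = 0)
    (hs : ∀ y z, ρ y z = ρ z y) (y₀ : Y) {c : Y →₀ ℝ} (hc : mass c = 0) :
    bilin (inducedKernel ρ y₀) c c = -(1 / 2) * bilin ρ c c := by
  rw [bilin_inducedKernel h0 hs, hc]
  simp

/-- The mean embedding of finitely supported functions into an inner product space. -/
theorem exists_meanEmbedding.{u} {Y : Type u} {ρ : Y → Y → ℝ} (h0 : ∀ y, ρ y y = 0)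
    (hs : ∀ y z, ρ y z = ρ z y)
    (hneg : ∀ c : Y →₀ ℝ, mass c = 0 → c ≠ 0 → bilin ρ c c < 0) (y₀ : Y) :
    ∃ (H : Type u) (_ : NormedAddCommGroup H) (_ : InnerProductSpace ℝ H) (Φ : (Y →₀ ℝ) →ₗ[ℝ] H),
      ∀ c c', inner ℝ (Φ c) (Φ c') = bilin (inducedKernel ρ y₀) c c' := by
  let V : Submodule ℝ (Y →₀ ℝ) := LinearMap.ker mass
  let core : InnerProductSpace.Core ℝ V :=
    { inner := fun f g => -(1 / 2) * bilin ρ f.1 g.1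
      conj_inner_symm := fun f g => by simp [bilin_symm hs]
      re_inner_nonneg := fun f => by
        by_cases hf : f.1 = 0
        · simp [hf]
        · have := hneg f.1 f.2 hf
          simp only [RCLike.re_to_real]
          linarith
      add_left := fun f g h => by simp; ring
      smul_left := fun f g a => by simp; ring
      definite := fun f hf => by
        by_contra h
        have := hneg f.1 f.2 (fun h' => h (Subtype.ext h'))
        have hf' : -(1 / 2) * bilin ρ f.1 f.1 = 0 := hf
        linarith }
  let i1 : NormedAddCommGroup V := core.toNormedAddCommGroup
  let i2 : InnerProductSpace ℝ V := InnerProductSpace.ofCore core.toCore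
  -- The Hilbert-type space is the mass-zero space itself, and the embedding is the recentring at
  -- `y₀`. Completeness is never needed.
  refine ⟨V, i1, i2, LinearMap.codRestrict V (LinearMap.id - Finsupp.lsingle y₀ ∘ₗ mass)
    (fun c => by simp [V]), fun c c' => ?_⟩
  rw [bilin_inducedKernel h0 hs]
  rfl

lemma meanEmbedding_eq_zero {Y H : Type*} [NormedAddCommGroup H] [InnerProductSpace ℝ H]
    {ρ : Y → Y → ℝ} (h0 : ∀ y, ρ y y = 0) (hs : ∀ y z, ρ y z = ρ z y)
    (hneg : ∀ c : Y →₀ ℝ, mass c = 0 → c ≠ 0 → bilin ρ c c < 0) {y₀ : Y}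
    {Φ : (Y →₀ ℝ) →ₗ[ℝ] H}
    (hΦ : ∀ c c', inner ℝ (Φ c) (Φ c') = bilin (inducedKernel ρ y₀) c c')
    {c : Y →₀ ℝ} (hc : mass c = 0) (h : Φ c = 0) : c = 0 := by
  by_contra hc0
  have h1 := hΦ c c
  rw [h, inner_zero_left, bilin_inducedKernel_of_mass_zero h0 hs y₀ hc] at h1
  linarith [hneg c hc hc0]

lemma mmd_atomic {H : Type*} [NormedAddCommGroup H] [InnerProductSpace ℝ H] {κ : Y → Y → ℝ}
    {Φ : (Y →₀ ℝ) →ₗ[ℝ] H} (hΦ : ∀ c c', inner ℝ (Φ c) (Φ c') = bilin κ c c') (c c' : Y →₀ ℝ) :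
    mmd κ (atomic c) (atomic c') = ‖Φ (c - c')‖ := by
  rw [mmd, kernelPairing_atomic, kernelPairing_atomic, kernelPairing_atomic, ← hΦ, ← hΦ, ← hΦ,
    map_sub, real_inner_self_eq_norm_sq, real_inner_self_eq_norm_sq, ← norm_sub_sq_real,
    Real.sqrt_sq (norm_nonneg _)]

lemma bilin_mapDomain {Y Z : Type*} {ρ : Y → Y → ℝ} {ρ' : Z → Z → ℝ} {b : Y → Z} {k : ℝ}
    (hb : ∀ y z, ρ' (b y) (b z) = k * ρ y z) (c c' : Y →₀ ℝ) :
    bilin ρ' (c.mapDomain b) (c'.mapDomain b) = k * bilin ρ c c' := by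
  have h : (bilin ρ').compl₁₂ (Finsupp.lmapDomain ℝ ℝ b) (Finsupp.lmapDomain ℝ ℝ b)
      = k • bilin ρ := by
    ext y z
    simp [hb]
  exact congrArg (fun f => f c c') h

end Embedding

/-! ### The signed categorical projection on finitely supported functions -/

section Projection

variable {Y H : Type*} [NormedAddCommGroup H] [InnerProductSpace ℝ H]

/-- Finitely supported functions of mass zero with support in `F`. -/
noncomputable def massZero (F : Finset Y) : Submodule ℝ (Y →₀ ℝ) :=
  Finsupp.supported ℝ ℝ (F : Set Y) ⊓ LinearMap.ker mass

lemma mem_massZero {F : Finset Y} {c : Y →₀ ℝ} :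
    c ∈ massZero F ↔ c.support ⊆ F ∧ mass c = 0 := by
  simp [massZero, Finsupp.mem_supported]

instance (F : Finset Y) : FiniteDimensional ℝ (massZero F) := by
  have : FiniteDimensional ℝ (Finsupp.supported ℝ ℝ (F : Set Y)) :=
    Module.Finite.equiv (Finsupp.supportedEquivFinsupp (F : Set Y)).symm
  exact Submodule.finiteDimensional_inf_left _ _

lemma sub_mem_massZero {F : Finset Y} {c c' : Y →₀ ℝ} (hc : c ∈ massOneFinsupp F)
    (hc' : c' ∈ massOneFinsupp F) : c - c' ∈ massZero F := by
  classical
  refine mem_massZero.2 ⟨Finsupp.support_sub.trans (Finset.union_subset hc.1 hc'.1), ?_⟩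
  rw [map_sub, hc.2, hc'.2, sub_self]

lemma add_mem_massOneFinsupp {F : Finset Y} {c v : Y →₀ ℝ} (hc : c ∈ massOneFinsupp F)
    (hv : v ∈ massZero F) : c + v ∈ massOneFinsupp F := by
  classical
  refine ⟨Finsupp.support_add.trans (Finset.union_subset hc.1 (mem_massZero.1 hv).1), ?_⟩
  rw [map_add, hc.2, (mem_massZero.1 hv).2, add_zero]

lemma single_mem_massOneFinsupp {F : Finset Y} {f : Y} (hf : f ∈ F) :
    Finsupp.single f 1 ∈ massOneFinsupp F :=
  ⟨Finsupp.support_single_subset.trans (by simpa using hf), mass_single f 1⟩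

/-- `L` is the orthogonal projection onto `massZero F` for the geometry induced by `Φ`. -/
structure IsMassZeroProj (Φ : (Y →₀ ℝ) →ₗ[ℝ] H) (F : Finset Y)
    (L : (Y →₀ ℝ) →ₗ[ℝ] (Y →₀ ℝ)) : Prop where
  mem : ∀ c, L c ∈ massZero F
  orthogonal : ∀ c, ∀ v ∈ massZero F, inner ℝ (Φ (c - L c)) (Φ v) = 0

/-- The image of `massZero F` under `Φ` is finite-dimensional, so an orthogonal projection onto it
exists even if `H` is incomplete; injectivity on mass zero pulls it back to functions. -/
lemma exists_isMassZeroProj {Φ : (Y →₀ ℝ) →ₗ[ℝ] H}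
    (hinj : ∀ c, mass c = 0 → Φ c = 0 → c = 0) (F : Finset Y) :
    ∃ L, IsMassZeroProj Φ F L := by
  let Ψ : massZero F →ₗ[ℝ] H := Φ ∘ₗ (massZero F).subtype
  have hΨ : Function.Injective Ψ := by
    intro v w h
    refine Subtype.ext (sub_eq_zero.1 (hinj _ (mem_massZero.1 (Submodule.sub_mem _ v.2 w.2)).2 ?_))
    rw [map_sub]
    exact sub_eq_zero.2 h
  let e := LinearEquiv.ofInjective Ψ hΨ
  let K := LinearMap.range Ψ
  let Q : (Y →₀ ℝ) →ₗ[ℝ] massZero F :=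
    e.symm.toLinearMap ∘ₗ (K.orthogonalProjectionOnto : H →ₗ[ℝ] K) ∘ₗ Φ
  refine ⟨(massZero F).subtype ∘ₗ Q, fun c => (Q c).2, fun c v hv => ?_⟩
  have h1 : Φ (Q c) = K.orthogonalProjectionOnto (Φ c) := by
    have h : e (Q c) = K.orthogonalProjectionOnto (Φ c) := e.apply_symm_apply _
    exact congrArg Subtype.val h
  have h2 : Φ v ∈ K := ⟨⟨v, hv⟩, rfl⟩
  rw [map_sub]
  change inner ℝ (Φ c - Φ (Q c)) (Φ v) = 0
  rw [h1]
  exact K.starProjection_inner_eq_zero (Φ c) _ h2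

namespace IsMassZeroProj

variable {Φ : (Y →₀ ℝ) →ₗ[ℝ] H} {F : Finset Y} {L : (Y →₀ ℝ) →ₗ[ℝ] (Y →₀ ℝ)}

/-- Pythagoras. It yields both nonexpansiveness and the minimality and uniqueness of the projection.
-/
lemma norm_sub_sq (hL : IsMassZeroProj Φ F L) (c : Y →₀ ℝ) {v : Y →₀ ℝ} (hv : v ∈ massZero F) :
    ‖Φ (v - c)‖ * ‖Φ (v - c)‖ = ‖Φ (c - L c)‖ * ‖Φ (c - L c)‖ + ‖Φ (L c - v)‖ * ‖Φ (L c - v)‖ := by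
  rw [← norm_add_sq_eq_norm_sq_add_norm_sq_real
    (hL.orthogonal c _ (Submodule.sub_mem _ (hL.mem c) hv)), ← map_add, sub_add_sub_cancel,
    ← norm_neg, ← map_neg, neg_sub]

lemma norm_le (hL : IsMassZeroProj Φ F L) (c : Y →₀ ℝ) : ‖Φ (L c)‖ ≤ ‖Φ c‖ := by
  have h := hL.norm_sub_sq c (Submodule.zero_mem _)
  rw [zero_sub, map_neg, norm_neg, sub_zero] at h
  refine (mul_self_le_mul_self_iff (norm_nonneg _) (norm_nonneg _)).2 ?_
  rw [h]
  exact le_add_of_nonneg_left (mul_self_nonneg _)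

lemma apply_of_mem (hL : IsMassZeroProj Φ F L) (hinj : ∀ c, mass c = 0 → Φ c = 0 → c = 0)
    {v : Y →₀ ℝ} (hv : v ∈ massZero F) : L v = v := by
  have hm : v - L v ∈ massZero F := Submodule.sub_mem _ hv (hL.mem v)
  have h := hL.orthogonal v _ hm
  rw [inner_self_eq_zero] at h
  exact (sub_eq_zero.1 (hinj _ (mem_massZero.1 hm).2 h)).symm

end IsMassZeroProj

/-- The affine map with linear part `L` and fixed point the unit mass at `f`. -/
noncomputable def affineProj (L : (Y →₀ ℝ) →ₗ[ℝ] (Y →₀ ℝ)) (f : Y) (c : Y →₀ ℝ) : Y →₀ ℝ :=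
  Finsupp.single f 1 + L (c - Finsupp.single f 1)

variable {Φ : (Y →₀ ℝ) →ₗ[ℝ] H} {F : Finset Y} {L : (Y →₀ ℝ) →ₗ[ℝ] (Y →₀ ℝ)} {f : Y}

lemma affineProj_sub (c c' : Y →₀ ℝ) : affineProj L f c - affineProj L f c' = L (c - c') := by
  simp only [affineProj, map_sub]
  abel

lemma affineProj_mem (hL : IsMassZeroProj Φ F L) (hf : f ∈ F) (c : Y →₀ ℝ) :
    affineProj L f c ∈ massOneFinsupp F :=
  add_mem_massOneFinsupp (single_mem_massOneFinsupp hf) (hL.mem _)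

lemma affineProj_of_mem (hL : IsMassZeroProj Φ F L)
    (hinj : ∀ c, mass c = 0 → Φ c = 0 → c = 0) (hf : f ∈ F) {c : Y →₀ ℝ}
    (hc : c ∈ massOneFinsupp F) : affineProj L f c = c := by
  rw [affineProj, hL.apply_of_mem hinj (sub_mem_massZero hc (single_mem_massOneFinsupp hf)),
    add_sub_cancel]

variable [MeasurableSpace Y] [MeasurableSingletonClass Y] {κ : Y → Y → ℝ}

/-- Translating by the unit mass at `f` turns the affine minimisation into an orthogonal projection
onto `massZero F`. The excess in Pythagoras vanishes only at the projected point, by injectivity on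
mass zero. -/
lemma isSignedProj_atomic_iff (hΦ : ∀ c c', inner ℝ (Φ c) (Φ c') = bilin κ c c')
    (hinj : ∀ c, mass c = 0 → Φ c = 0 → c = 0) (hL : IsMassZeroProj Φ F L) (hf : f ∈ F)
    (c : Y →₀ ℝ) (p : SignedMeasure Y) :
    IsSignedProj κ (F : Set Y) (atomic c) p ↔ p = atomic (affineProj L f c) := by
  have hpyth : ∀ c' ∈ massOneFinsupp F, ‖Φ (c' - c)‖ * ‖Φ (c' - c)‖
      = ‖Φ (affineProj L f c - c)‖ * ‖Φ (affineProj L f c - c)‖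
        + ‖Φ (affineProj L f c - c')‖ * ‖Φ (affineProj L f c - c')‖ := by
    intro c' hc'
    have h := hL.norm_sub_sq (c - Finsupp.single f 1)
      (sub_mem_massZero hc' (single_mem_massOneFinsupp hf))
    rw [sub_sub_sub_cancel_right] at h
    have e1 : affineProj L f c - c = -(c - Finsupp.single f 1 - L (c - Finsupp.single f 1)) := by
      rw [affineProj]; abel
    have e2 : affineProj L f c - c'
        = L (c - Finsupp.single f 1) - (c' - Finsupp.single f 1) := by
      rw [affineProj]; abel
    rw [h, e1, e2, map_neg, norm_neg]
  have hmin : IsSignedProj κ (F : Set Y) (atomic c) (atomic (affineProj L f c)) := by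
    refine ⟨(atomic_mem_massOne_iff _ _).2 (affineProj_mem hL hf c), fun p' hp' => ?_⟩
    obtain ⟨c', hc', rfl⟩ := exists_atomic_eq hp'
    rw [mmd_atomic hΦ, mmd_atomic hΦ]
    refine (mul_self_le_mul_self_iff (norm_nonneg _) (norm_nonneg _)).2 ?_
    rw [hpyth c' hc']
    exact le_add_of_nonneg_right (mul_self_nonneg _)
  refine ⟨fun hp => ?_, fun h => h ▸ hmin⟩
  obtain ⟨c', hc', rfl⟩ := exists_atomic_eq hp.1
  have h := hp.2 _ hmin.1
  rw [mmd_atomic hΦ, mmd_atomic hΦ] at h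
  have h1 := mul_self_le_mul_self (norm_nonneg _) h
  rw [hpyth c' hc', add_le_iff_nonpos_right] at h1
  have h2 : Φ (affineProj L f c - c') = 0 :=
    norm_eq_zero.1 (mul_self_eq_zero.1 (le_antisymm h1 (mul_self_nonneg _)))
  rw [← sub_eq_zero.1 (hinj _
    (mem_massZero.1 (sub_mem_massZero (affineProj_mem hL hf c) hc')).2 h2)]

lemma signedProj_atomic (hΦ : ∀ c c', inner ℝ (Φ c) (Φ c') = bilin κ c c')
    (hinj : ∀ c, mass c = 0 → Φ c = 0 → c = 0) (hL : IsMassZeroProj Φ F L) (hf : f ∈ F)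
    (c : Y →₀ ℝ) : signedProj κ (F : Set Y) (atomic c) = atomic (affineProj L f c) := by
  have h := isSignedProj_atomic_iff hΦ hinj hL hf c
  exact (h _).1 (Classical.epsilon_spec ⟨_, (h _).2 rfl⟩)

end Projection

/-! ### Fixed points of sup-norm contractions -/

/-- A linear map that contracts the supremum over `x` of `‖Φ (v x)‖` on a product of
finite-dimensional subspaces where `Φ` is injective yields uniquely solvable affine equations. -/
lemma existsUnique_eq_add_of_contraction {X V H : Type*} [Finite X] [AddCommGroup V] [Module ℝ V]
    [NormedAddCommGroup H] [NormedSpace ℝ H] (Φ : V →ₗ[ℝ] H) (W : X → Submodule ℝ V)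
    [∀ x, FiniteDimensional ℝ (W x)] (hinj : ∀ x, ∀ v ∈ W x, Φ v = 0 → v = 0)
    (T : (X → V) →ₗ[ℝ] (X → V)) (hT : ∀ (v : X → V) (x : X), T v x ∈ W x) {β : ℝ} (hβ : β < 1)
    (hcontr : ∀ v : X → V, (∀ x, v x ∈ W x) → ∀ M, (∀ x, ‖Φ (v x)‖ ≤ M) →
      ∀ x, ‖Φ (T v x)‖ ≤ β * M) (u : X → V) (hu : ∀ x, u x ∈ W x) :
    ∃! v : X → V, (∀ x, v x ∈ W x) ∧ v = u + T v := by
  -- At a state where `‖Φ (v x)‖` is maximal, the contraction forces this maximum to be at most `β`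
  -- times itself.
  have hzero : ∀ v : X → V, (∀ x, v x ∈ W x) → v = T v → v = 0 := by
    intro v hv h
    funext x
    have : Nonempty X := ⟨x⟩
    obtain ⟨x₁, hx₁⟩ := Finite.exists_max fun x => ‖Φ (v x)‖
    have h1 := hcontr v hv _ hx₁ x₁
    rw [← h] at h1
    have h2 : ‖Φ (v x₁)‖ ≤ 0 := by nlinarith [norm_nonneg (Φ (v x₁))]
    exact hinj x _ (hv x) (norm_le_zero_iff.1 ((hx₁ x).trans h2))
  let ι : (∀ x, W x) →ₗ[ℝ] (X → V) := LinearMap.pi fun x => (W x).subtype ∘ₗ LinearMap.proj x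
  let T' : (∀ x, W x) →ₗ[ℝ] (∀ x, W x) :=
    LinearMap.pi fun x => LinearMap.codRestrict (W x) (LinearMap.proj x ∘ₗ T ∘ₗ ι)
      fun v => hT (ι v) x
  have hι : ∀ v, ι (T' v) = T (ι v) := fun v => rfl
  have hinj' : Function.Injective ((LinearMap.id : (∀ x, W x) →ₗ[ℝ] (∀ x, W x)) - T') := by
    refine LinearMap.ker_eq_bot.1 (LinearMap.ker_eq_bot'.2 fun v hv => ?_)
    have h1 : v = T' v := sub_eq_zero.1 hv
    have h2 := hzero (ι v) (fun x => (v x).2) (by rw [← hι, ← h1])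
    funext x
    exact Subtype.ext (congrFun h2 x)
  obtain ⟨v, hv⟩ := LinearMap.injective_iff_surjective.1 hinj' fun x => ⟨u x, hu x⟩
  have hv' : ι v = u + T (ι v) := by
    have h : ι (v - T' v) = u := congrArg ι hv
    rw [← hι, ← h, map_sub, sub_add_cancel]
  refine ⟨ι v, ⟨fun x => (v x).2, hv'⟩, fun w hw => sub_eq_zero.1 (hzero _ (fun x => ?_) ?_)⟩
  · exact Submodule.sub_mem _ (hw.1 x) (v x).2
  · rw [map_sub]
    conv_lhs => rw [hw.2, hv']
    abel

/-! ### The Bellman backup contracts the mean embedding -/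

/-- On mass zero the squared norm is `-(1/2) * bilin ρ`, which the backup map scales by `k`: the
translation is invisible to `ρ` and the dilation is homogeneous. -/
lemma norm_meanEmbedding_mapDomain_boot {E H : Type*} [AddCommGroup E] [Module ℝ E]
    [NormedAddCommGroup H] [InnerProductSpace ℝ H] {ρ : E → E → ℝ} (h0 : ∀ y, ρ y y = 0)
    (hs : ∀ y z, ρ y z = ρ z y) (hshift : ShiftInvariant ρ) {γ k : ℝ} (hk : 0 ≤ k)
    (hhom : ∀ y z, ρ (γ • y) (γ • z) = k * ρ y z) {y₀ : E} {Φ : (E →₀ ℝ) →ₗ[ℝ] H}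
    (hΦ : ∀ c c', inner ℝ (Φ c) (Φ c') = bilin (inducedKernel ρ y₀) c c')
    (y : E) {v : E →₀ ℝ} (hv : mass v = 0) :
    ‖Φ (v.mapDomain (boot γ y))‖ = √k * ‖Φ v‖ := by
  have hb : ∀ z w, ρ (boot γ y z) (boot γ y w) = k * ρ z w := fun z w => by
    rw [boot, boot, hshift, hhom]
  rw [norm_eq_sqrt_real_inner, norm_eq_sqrt_real_inner, ← Real.sqrt_mul hk, hΦ, hΦ,
    bilin_inducedKernel_of_mass_zero h0 hs y₀ hv,
    bilin_inducedKernel_of_mass_zero h0 hs y₀ (by rw [mass_mapDomain, hv]), bilin_mapDomain hb]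
  congr 1
  ring

/-! ### Deterministic stochastic-approximation recursions -/

/-- Iterate `1 - a ≤ exp (-a)`. As `u` is nonnegative, the sign of `1 - a` does not matter. -/
lemma tendsto_zero_of_le_one_sub_mul {u a : ℕ → ℝ} (hu : ∀ t, 0 ≤ u t)
    (hrec : ∀ t, u (t + 1) ≤ (1 - a t) * u t)
    (hsum : Tendsto (fun n => ∑ t ∈ Finset.range n, a t) atTop atTop) :
    Tendsto u atTop (𝓝 0) := by
  have h : ∀ n, u n ≤ u 0 * Real.exp (-∑ t ∈ Finset.range n, a t) := by
    intro n
    induction n with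
    | zero => simp
    | succ n ih =>
      calc u (n + 1) ≤ (1 - a n) * u n := hrec n
        _ ≤ Real.exp (-a n) * u n := by
          gcongr
          · exact hu n
          · linarith [Real.add_one_le_exp (-a n)]
        _ ≤ Real.exp (-a n) * (u 0 * Real.exp (-∑ t ∈ Finset.range n, a t)) := by gcongr
        _ = u 0 * Real.exp (-∑ t ∈ Finset.range (n + 1), a t) := by
          rw [Finset.sum_range_succ, neg_add, Real.exp_add]; ring
  refine squeeze_zero hu h ?_
  have := (Real.tendsto_exp_atBot.comp (tendsto_neg_atTop_atBot.comp hsum)).const_mul (u 0)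
  simpa using this

lemma eventually_le_of_le_one_sub_mul_add {u a : ℕ → ℝ} {C : ℝ} (T : ℕ)
    (ha1 : ∀ t ≥ T, a t ≤ 1)
    (hrec : ∀ t ≥ T, u (t + 1) ≤ (1 - a t) * u t + a t * C)
    (hsum : Tendsto (fun n => ∑ t ∈ Finset.range n, a t) atTop atTop) {δ : ℝ} (hδ : 0 < δ) :
    ∀ᶠ t in atTop, u t ≤ C + δ := by
  -- The positive part of the excess over `C` satisfies the homogeneous recursion once the factors
  -- `1 - a t` are nonnegative.
  have hlim : Tendsto (fun t => max (u (t + T) - C) 0) atTop (𝓝 0) := by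
    refine tendsto_zero_of_le_one_sub_mul (a := fun t => a (t + T)) (fun t => le_max_right _ _)
      (fun t => ?_) ?_
    · have h1 := hrec (t + T) (by omega)
      have h2 : 0 ≤ 1 - a (t + T) := by linarith [ha1 (t + T) (by omega)]
      refine max_le ?_ (mul_nonneg h2 (le_max_right _ _))
      calc u (t + 1 + T) - C = u (t + T + 1) - C := by congr 2; omega
        _ ≤ (1 - a (t + T)) * (u (t + T) - C) := by linarith
        _ ≤ (1 - a (t + T)) * max (u (t + T) - C) 0 := by gcongr; exact le_max_left _ _
    · have h := (hsum.comp (tendsto_add_atTop_nat T))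
      have h' := tendsto_atTop_add_const_right _ (-∑ t ∈ Finset.range T, a t) h
      refine h'.congr fun n => ?_
      simp only [Function.comp]
      rw [add_comm n T, Finset.sum_range_add]
      simp [add_comm]
  obtain ⟨N, hN⟩ := eventually_atTop.1 (hlim.eventually (gt_mem_nhds hδ))
  refine eventually_atTop.2 ⟨N + T, fun t ht => ?_⟩
  have h := hN (t - T) (by omega)
  rw [Nat.sub_add_cancel (by omega)] at h
  linarith [le_max_left (u t - C) 0]

/-- An asynchronous recursion with contraction factor `β < 1` in the supremum norm, vanishing
perturbations and Robbins–Monro step sizes tends to zero. -/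
theorem tendsto_zero_of_contractive_recursion {X : Type*} [Finite X] {y a e : ℕ → X → ℝ}
    {β : ℝ} (hβ0 : 0 ≤ β) (hβ1 : β < 1) (hy : ∀ t x, 0 ≤ y t x) (ha : ∀ t x, 0 ≤ a t x)
    (ha0 : ∀ x, Tendsto (fun t => a t x) atTop (𝓝 0))
    (hsum : ∀ x, Tendsto (fun n => ∑ t ∈ Finset.range n, a t x) atTop atTop)
    (he : ∀ x, Tendsto (fun t => e t x) atTop (𝓝 0))
    (hrec : ∀ t x M, (∀ x', y t x' ≤ M) →
      y (t + 1) x ≤ |1 - a t x| * y t x + a t x * (β * M + e t x)) (x : X) :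
    Tendsto (fun t => y t x) atTop (𝓝 0) := by
  have hX : Nonempty X := ⟨x⟩
  obtain ⟨T, hT⟩ : ∃ T, ∀ t ≥ T, ∀ x, a t x ≤ 1 ∧ e t x ≤ 1 := by
    refine eventually_atTop.1 (eventually_all.2 fun x => ?_)
    exact ((ha0 x).eventually (ge_mem_nhds one_pos)).and ((he x).eventually (ge_mem_nhds one_pos))
  have hrec' : ∀ t ≥ T, ∀ x M, (∀ x', y t x' ≤ M) →
      y (t + 1) x ≤ (1 - a t x) * y t x + a t x * (β * M + e t x) := by
    intro t ht x M hM
    have h := hrec t x M hM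
    rwa [abs_of_nonneg (by linarith [(hT t ht x).1])] at h
  obtain ⟨x₁, hx₁⟩ := Finite.exists_max (y T)
  -- The bound `1 / (1 - β) ≤ D` says `β * D + 1 ≤ D`, so `D` is preserved by the recursion while
  -- the perturbations are at most one.
  obtain ⟨D₀, hD₀, hD₀'⟩ : ∃ D, y T x₁ ≤ D ∧ 1 / (1 - β) ≤ D :=
    ⟨_, le_max_left _ _, le_max_right _ _⟩
  have hβ' : 0 < 1 - β := by linarith
  have hbdd : ∀ t ≥ T, ∀ x, y t x ≤ D₀ := by
    intro t ht
    induction t, ht using Nat.le_induction with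
    | base => exact fun x => (hx₁ x).trans hD₀
    | succ t ht ih =>
      intro x
      have h1 := hrec' t ht x D₀ ih
      have h2 : β * D₀ + e t x ≤ D₀ := by
        have := (hT t ht x).2
        rw [div_le_iff₀ hβ'] at hD₀'
        linarith
      have h3 := mul_le_mul_of_nonneg_left h2 (ha t x)
      have h4 := mul_le_mul_of_nonneg_left (ih x) (by linarith [(hT t ht x).1] : 0 ≤ 1 - a t x)
      linarith
  -- The infimum of the eventual uniform bounds plays the role of the limit superior; each bound `D`
  -- improves to `β * D + δ`, which forces the infimum down to zero.
  set S : Set ℝ := {D | ∀ᶠ t in atTop, ∀ x, y t x ≤ D} with hS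
  have hS0 : D₀ ∈ S := eventually_atTop.2 ⟨T, fun t ht => hbdd t ht⟩
  have hSnn : ∀ D ∈ S, 0 ≤ D := by
    intro D hD
    obtain ⟨t, ht⟩ := hD.exists
    exact (hy t x).trans (ht x)
  have hSb : BddBelow S := ⟨0, hSnn⟩
  have hstep : ∀ D ∈ S, ∀ δ > 0, β * D + δ ∈ S := by
    intro D hD δ hδ
    refine eventually_all.2 fun x => ?_
    obtain ⟨T', hT'⟩ := eventually_atTop.1
      (hD.and ((he x).eventually (ge_mem_nhds (half_pos hδ))))
    have := eventually_le_of_le_one_sub_mul_add (u := fun t => y t x) (a := fun t => a t x)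
      (C := β * D + δ / 2) (max T T') (fun t ht => (hT t (le_of_max_le_left ht) x).1)
      (fun t ht => ?_) (hsum x) (half_pos hδ)
    · filter_upwards [this] with t ht
      linarith
    · have h1 := hrec' t (le_of_max_le_left ht) x D (hT' t (le_of_max_le_right ht)).1
      have h2 := mul_le_mul_of_nonneg_left (hT' t (le_of_max_le_right ht)).2 (ha t x)
      linarith
  have hinf : sInf S ≤ 0 := by
    by_contra! hpos
    have h : sInf S ≤ β * sInf S := by
      refine le_of_forall_pos_le_add fun δ hδ => ?_
      obtain ⟨D, hD, hlt⟩ := exists_lt_of_csInf_lt ⟨_, hS0⟩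
        (show sInf S < sInf S + δ / 2 by linarith)
      have h1 := csInf_le hSb (hstep D hD (δ / 2) (half_pos hδ))
      nlinarith [csInf_le hSb hD]
    nlinarith
  refine tendsto_order.2 ⟨fun b hb => Eventually.of_forall fun t => hb.trans_le (hy t x),
    fun b hb => ?_⟩
  obtain ⟨D, hD, hlt⟩ := exists_lt_of_csInf_lt ⟨_, hS0⟩ (hinf.trans_lt hb)
  filter_upwards [hD] with t ht
  exact (ht x).trans_lt hlt

/-! ### Almost sure convergence of martingale transforms -/

section MartingaleTransform

variable {Ω : Type*} {mΩ : MeasurableSpace Ω} {μ : Measure Ω} [IsProbabilityMeasure μ]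

/-- The partial sums form a martingale whose increments are orthogonal, so its second moments are
bounded by `M`; the martingale convergence theorem applies. -/
lemma ae_exists_tendsto_sum_of_sum_sq_le (ℱ : Filtration ℕ mΩ) {a ξ : ℕ → Ω → ℝ} {M : ℝ}
    (ha : ∀ t, StronglyMeasurable[ℱ t] (a t)) (hξ : ∀ t, StronglyMeasurable[ℱ (t + 1)] (ξ t))
    (hb : ∀ t ω, |ξ t ω| ≤ 1) (hc : ∀ t, μ[ξ t | ℱ t] =ᵐ[μ] 0)
    (hsq : ∀ n ω, ∑ t ∈ Finset.range n, a t ω ^ 2 ≤ M) :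
    ∀ᵐ ω ∂μ, ∃ l, Tendsto (fun n => ∑ t ∈ Finset.range n, a t ω * ξ t ω) atTop (𝓝 l) := by
  have haM : ∀ t ω, a t ω ^ 2 ≤ M := fun t ω =>
    (Finset.single_le_sum (f := fun t => a t ω ^ 2) (fun _ _ => sq_nonneg _)
      (Finset.self_mem_range_succ t)).trans (hsq (t + 1) ω)
  have habs : ∀ t ω, |a t ω| ≤ √M := fun t ω => Real.abs_le_sqrt (haM t ω)
  set S : ℕ → Ω → ℝ := fun n ω => ∑ t ∈ Finset.range n, a t ω * ξ t ω with hS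
  have hterm : ∀ t ω, |a t ω * ξ t ω| ≤ √M := fun t ω => by
    rw [abs_mul]
    exact (mul_le_mul (habs t ω) (hb t ω) (abs_nonneg _) (Real.sqrt_nonneg _)).trans_eq (mul_one _)
  have hSbd : ∀ n ω, |S n ω| ≤ n * √M := fun n ω =>
    (Finset.abs_sum_le_sum_abs _ _).trans
      ((Finset.sum_le_sum fun t _ => hterm t ω).trans_eq (by simp))
  have htm : ∀ t, StronglyMeasurable[ℱ (t + 1)] (fun ω => a t ω * ξ t ω) := fun t =>
    ((ha t).mono (ℱ.mono (Nat.le_succ t))).mul (hξ t)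
  have hSm : ∀ n, StronglyMeasurable[ℱ n] (S n) := by
    intro n
    refine Finset.stronglyMeasurable_fun_sum _ fun t ht => ?_
    exact (htm t).mono (ℱ.mono (Finset.mem_range.1 ht))
  have hint : ∀ {f : Ω → ℝ} {n : ℕ} {K : ℝ}, StronglyMeasurable[ℱ n] f → (∀ ω, |f ω| ≤ K) →
      Integrable f μ := fun hf hK =>
    Integrable.of_bound ((hf.mono (ℱ.le _)).aestronglyMeasurable) _ (Eventually.of_forall hK)
  have hSint : ∀ n, Integrable (S n) μ := fun n => hint (hSm n) (hSbd n)
  have hξint : ∀ t, Integrable (ξ t) μ := fun t => hint (hξ t) (hb t)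
  have hpull : ∀ {f : Ω → ℝ} {t : ℕ} {K : ℝ}, StronglyMeasurable[ℱ t] f → (∀ ω, |f ω| ≤ K) →
      μ[f * ξ t | ℱ t] =ᵐ[μ] 0 := by
    intro f t K hf hK
    have h := condExp_stronglyMeasurable_mul_of_bound (ℱ.le t) hf (hξint t) K
      (Eventually.of_forall hK)
    filter_upwards [h, hc t] with ω h1 h2
    rw [h1, Pi.mul_apply, h2, Pi.zero_apply, mul_zero]
  have hmart : Martingale S ℱ μ := by
    refine martingale_of_condExp_sub_eq_zero_nat (fun n => hSm n) hSint fun t => ?_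
    have : S (t + 1) - S t = a t * ξ t := by
      ext ω
      simp [hS, Finset.sum_range_succ]
    rw [this]
    exact hpull (ha t) (habs t)
  have hsqint : ∀ n, Integrable (fun ω => S n ω ^ 2) μ := fun n =>
    hint (K := (n * √M) ^ 2) ((hSm n).pow 2) (fun ω => by
      rw [abs_pow]; exact pow_le_pow_left₀ (abs_nonneg _) (hSbd n ω) 2)
  have haint : ∀ t, Integrable (fun ω => a t ω ^ 2) μ := fun t =>
    hint (K := M) ((ha t).pow 2) (fun ω => by
      rw [abs_of_nonneg (sq_nonneg _)]; exact haM t ω)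
  have hL2 : ∀ n, ∫ ω, S n ω ^ 2 ∂μ ≤ ∑ t ∈ Finset.range n, ∫ ω, a t ω ^ 2 ∂μ := by
    intro n
    induction n with
    | zero => simp [hS]
    | succ n ih =>
      have hcrossm : StronglyMeasurable[ℱ n] (fun ω => S n ω * a n ω) := (hSm n).mul (ha n)
      have hcrossb : ∀ ω, |S n ω * a n ω| ≤ n * √M * √M := fun ω => by
        rw [abs_mul]
        exact mul_le_mul (hSbd n ω) (habs n ω) (abs_nonneg _)
          (mul_nonneg (Nat.cast_nonneg _) (Real.sqrt_nonneg _))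
      -- Orthogonality: `S n * a n` is known at time `n`, and `ξ n` is conditionally centred.
      have hcross : ∫ ω, S n ω * a n ω * ξ n ω ∂μ = 0 := by
        have h := integral_condExp (μ := μ) (ℱ.le n) (f := (fun ω => S n ω * a n ω) * ξ n)
        rw [integral_congr_ae (hpull hcrossm hcrossb)] at h
        simpa using h.symm
      have hcrossint : Integrable (fun ω => S n ω * a n ω * ξ n ω) μ :=
        hint (K := n * √M * √M) ((hcrossm.mono (ℱ.mono (Nat.le_succ n))).mul (hξ n)) (fun ω => by
          rw [abs_mul]
          exact (mul_le_mul (hcrossb ω) (hb n ω) (abs_nonneg _)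
            ((abs_nonneg _).trans (hcrossb ω))).trans_eq (mul_one _))
      have hsumint : Integrable (fun ω => S n ω ^ 2 + 2 * (S n ω * a n ω * ξ n ω)) μ :=
        (hsqint n).add (hcrossint.const_mul 2)
      calc ∫ ω, S (n + 1) ω ^ 2 ∂μ
          ≤ ∫ ω, (S n ω ^ 2 + 2 * (S n ω * a n ω * ξ n ω)) + a n ω ^ 2 ∂μ := by
            refine integral_mono (hsqint _) (hsumint.add (haint n)) fun ω => ?_
            have h1 : S (n + 1) ω = S n ω + a n ω * ξ n ω := by simp [hS, Finset.sum_range_succ]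
            have h2 : (a n ω * ξ n ω) ^ 2 ≤ a n ω ^ 2 := by
              rw [mul_pow]
              exact mul_le_of_le_one_right (sq_nonneg _) ((sq_le_one_iff_abs_le_one _).2 (hb n ω))
            simp only [h1]
            nlinarith
        _ = ∫ ω, S n ω ^ 2 ∂μ + ∫ ω, a n ω ^ 2 ∂μ := by
            rw [integral_add hsumint (haint n),
              integral_add (hsqint n) (hcrossint.const_mul 2), integral_const_mul, hcross]
            ring
        _ ≤ _ := by rw [Finset.sum_range_succ]; gcongr
  have hL2M : ∀ n, ∫ ω, S n ω ^ 2 ∂μ ≤ M := fun n => by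
    refine (hL2 n).trans ?_
    rw [← integral_finsetSum _ fun t _ => haint t]
    refine (integral_mono (integrable_finsetSum _ fun t _ => haint t) (integrable_const M)
      fun ω => hsq n ω).trans_eq (by simp)
  -- The L¹ bound `1 + M` comes from `|s| ≤ 1 + s ^ 2`.
  refine hmart.submartingale.exists_ae_tendsto_of_bdd (R := (1 + M).toNNReal) fun n => ?_
  rw [eLpNorm_one_eq_lintegral_enorm, ← ofReal_integral_norm_eq_lintegral_enorm (hSint n)]
  refine ENNReal.ofReal_le_ofReal ?_
  calc ∫ ω, ‖S n ω‖ ∂μ ≤ ∫ ω, 1 + S n ω ^ 2 ∂μ := by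
        refine integral_mono (hSint n).norm ((integrable_const 1).add (hsqint n)) fun ω => ?_
        simp only [Real.norm_eq_abs]
        nlinarith [sq_abs (S n ω), sq_nonneg (|S n ω| - 1)]
    _ ≤ 1 + M := by
        rw [integral_add (integrable_const 1) (hsqint n)]
        simpa using hL2M n

/-- Sums of conditionally centred bounded variables with square-summable predictable weights
converge almost surely. -/
theorem ae_exists_tendsto_sum_of_summable_sq (ℱ : Filtration ℕ mΩ) {a ξ : ℕ → Ω → ℝ}
    (ha : ∀ t, StronglyMeasurable[ℱ t] (a t)) (hξ : ∀ t, StronglyMeasurable[ℱ (t + 1)] (ξ t))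
    (hb : ∀ t ω, |ξ t ω| ≤ 1) (hc : ∀ t, μ[ξ t | ℱ t] =ᵐ[μ] 0)
    (hsq : ∀ᵐ ω ∂μ, Summable fun t => a t ω ^ 2) :
    ∀ᵐ ω ∂μ, ∃ l, Tendsto (fun n => ∑ t ∈ Finset.range n, a t ω * ξ t ω) atTop (𝓝 l) := by
  -- Localisation: a weight is switched off once the sum of squares, its own square included,
  -- exceeds `M`. Including the current term bounds the truncated sum by `M`, and the event is still
  -- known at time `t` because `a t` is.
  let good : ℕ → ℕ → Set Ω := fun M t => {ω | ∑ s ∈ Finset.range (t + 1), a s ω ^ 2 ≤ M}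
  have hgood : ∀ M t, MeasurableSet[ℱ t] (good M t) := by
    intro M t
    have h : StronglyMeasurable[ℱ t] (fun ω => ∑ s ∈ Finset.range (t + 1), a s ω ^ 2) :=
      Finset.stronglyMeasurable_fun_sum _ fun s hs =>
        ((ha s).mono (ℱ.mono (Nat.lt_succ_iff.1 (Finset.mem_range.1 hs)))).pow 2
    exact h.measurable measurableSet_Iic
  have key : ∀ M : ℕ, ∀ᵐ ω ∂μ, ∃ l, Tendsto
      (fun n => ∑ t ∈ Finset.range n, (good M t).indicator (a t) ω * ξ t ω) atTop (𝓝 l) := by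
    intro M
    refine ae_exists_tendsto_sum_of_sum_sq_le ℱ (M := M) (fun t => (ha t).indicator (hgood M t))
      hξ hb hc fun n ω => ?_
    induction n with
    | zero => simp
    | succ n ih =>
      by_cases h : ω ∈ good M n
      · refine le_trans (Finset.sum_le_sum fun t _ => ?_) h
        by_cases h' : ω ∈ good M t
        · rw [Set.indicator_of_mem h']
        · rw [Set.indicator_of_notMem h']
          simpa using sq_nonneg (a t ω)
      · rw [Finset.sum_range_succ, Set.indicator_of_notMem h]
        simpa using ih
  filter_upwards [ae_all_iff.2 key, hsq] with ω h1 h2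
  -- For `M` above the full sum of squares, nothing is truncated along this path.
  obtain ⟨M, hM⟩ := exists_nat_ge (∑' t, a t ω ^ 2)
  obtain ⟨l, hl⟩ := h1 M
  refine ⟨l, hl.congr fun n => Finset.sum_congr rfl fun t _ => ?_⟩
  rw [Set.indicator_of_mem]
  exact (h2.sum_le_tsum _ fun _ _ => sq_nonneg _).trans hM

end MartingaleTransform

/-! ### The noise of sampled transitions is conditionally centred -/

section Transitions

variable {Ω X A E : Type*} [MeasurableSpace X] [MeasurableSpace A]
  [MeasurableSpace E]

lemma policyKernel_real_singleton [MeasurableSingletonClass X] (π : Kernel X A) [IsMarkovKernel π]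
    (P : Kernel (X × A) X) [IsMarkovKernel P] (x x' : X) :
    (policyKernel π P x).real {x'} = ∫ a, (P (x, a)).real {x'} ∂(π x) := by
  have hx' := measurableSet_singleton x'
  have hmeas : Measurable fun a => P (x, a) {x'} :=
    (Kernel.measurable_coe P hx').comp measurable_prodMk_left
  rw [Measure.real, policyKernel, Kernel.snd_apply' _ _ hx',
    Kernel.compProd_apply (measurable_snd hx')]
  simp only [Measure.real]
  rw [integral_toReal hmeas.aemeasurable (Eventually.of_forall fun a => measure_lt_top _ _)]
  rfl

variable {Xs : ℕ → Ω → X} {As : ℕ → Ω → A} {R : ℕ → Ω → E} {X' : ℕ → Ω → X}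

lemma transition_comap_le_preHistory {s t : ℕ} (h : s < t) :
    MeasurableSpace.comap (fun ω => (Xs s ω, As s ω, R s ω, X' s ω)) inferInstance
      ≤ preHistory Xs As R X' t :=
  le_sup_of_le_left (le_iSup₂_of_le s h le_rfl)

lemma measurable_state_preHistory (t : ℕ) : Measurable[preHistory Xs As R X' t] (Xs t) :=
  measurable_iff_comap_le.2 le_sup_right

lemma measurable_next_preHistory (t : ℕ) : Measurable[preHistory Xs As R X' (t + 1)] (X' t) := by
  have h : Measurable[preHistory Xs As R X' (t + 1)] fun ω => (Xs t ω, As t ω, R t ω, X' t ω) :=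
    measurable_iff_comap_le.2 (transition_comap_le_preHistory t.lt_succ_self)
  exact measurable_snd.comp (measurable_snd.comp (measurable_snd.comp h))

lemma preHistory_mono : Monotone (preHistory Xs As R X') := by
  intro s t hst
  rcases hst.eq_or_lt with rfl | hlt
  · exact le_rfl
  · refine sup_le (iSup₂_le fun u hu => transition_comap_le_preHistory (hu.trans_le hst)) ?_
    have h : Measurable[preHistory Xs As R X' t] fun ω => (Xs s ω, As s ω, R s ω, X' s ω) :=
      measurable_iff_comap_le.2 (transition_comap_le_preHistory hlt)
    exact measurable_iff_comap_le.1 (measurable_fst.comp h)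

variable [mΩ : MeasurableSpace Ω] [Finite X] [MeasurableSingletonClass X] {μ : Measure Ω} {π : Kernel X A}
  {P : Kernel (X × A) X} {r : X → E}

namespace IsTransitionStream

lemma preHistory_le (hT : IsTransitionStream μ π P r Xs As R X') (t : ℕ) :
    preHistory Xs As R X' t ≤ mΩ := by
  have hr : ∀ s, Measurable (R s) := fun s => by
    have : R s = r ∘ Xs s := funext (hT.reward_eq s)
    rw [this]
    exact (measurable_of_finite r).comp (hT.measurable_state s)
  refine sup_le (iSup₂_le fun s _ => ?_) (hT.measurable_state t).comap_le
  exact ((hT.measurable_state s).prodMk ((hT.measurable_action s).prodMk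
    ((hr s).prodMk (hT.measurable_next s)))).comap_le

/-- The filtration generated by the past transitions and the current state. -/
def filtration (hT : IsTransitionStream μ π P r Xs As R X') : Filtration ℕ mΩ where
  seq := preHistory Xs As R X'
  mono' := preHistory_mono
  le' := hT.preHistory_le

variable [IsProbabilityMeasure μ] [IsMarkovKernel π]

/-- The conditional law of the action becomes an identity of measures on a past event where the
state is constant, so functions of the action can be integrated by change of variables. -/
lemma map_action_restrict (hT : IsTransitionStream μ π P r Xs As R X') (t : ℕ) {x : X} {D : Set Ω}
    (hD : MeasurableSet[preHistory Xs As R X' t] D) (hDx : ∀ ω ∈ D, Xs t ω = x) :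
    (μ.restrict D).map (As t) = μ D • π x := by
  have hm := hT.preHistory_le t
  ext B hB
  have hAB : MeasurableSet (As t ⁻¹' B) := hT.measurable_action t hB
  have hint : Integrable ((As t ⁻¹' B).indicator fun _ => (1 : ℝ)) μ :=
    (integrable_const 1).indicator hAB
  have h1 := setIntegral_condExp hm hint hD
  rw [setIntegral_congr_ae (g := fun _ => (π x).real B) (hm D hD)
      ((hT.action_law t B hB).mono fun ω h hω => by
        rw [h]; simp only [hDx ω hω]),
    setIntegral_const, integral_indicator hAB, integral_const] at h1
  rw [Measure.map_apply (hT.measurable_action t) hB, Measure.smul_apply, smul_eq_mul,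
    ← ENNReal.toReal_eq_toReal_iff' (measure_ne_top _ _)
      (ENNReal.mul_ne_top (measure_ne_top _ _) (measure_ne_top _ _)), ENNReal.toReal_mul]
  simpa [Measure.real, Measure.restrict_apply_univ] using h1.symm

variable [IsMarkovKernel P]

/-- Tower property: condition on the history together with the action, then average the action out
under `π x`. -/
lemma setIntegral_next (hT : IsTransitionStream μ π P r Xs As R X') (t : ℕ) {x : X} (x' : X)
    {D : Set Ω} (hD : MeasurableSet[preHistory Xs As R X' t] D) (hDx : ∀ ω ∈ D, Xs t ω = x) :
    ∫ ω in D, (X' t ⁻¹' {x'}).indicator (fun _ => (1 : ℝ)) ω ∂μ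
      = μ.real D * (policyKernel π P x).real {x'} := by
  have hx' := measurableSet_singleton x'
  have hm : preHistory Xs As R X' t ⊔ MeasurableSpace.comap (As t) inferInstance ≤ mΩ :=
    sup_le (hT.preHistory_le t) (hT.measurable_action t).comap_le
  have hint : Integrable ((X' t ⁻¹' {x'}).indicator fun _ => (1 : ℝ)) μ :=
    (integrable_const 1).indicator (hT.measurable_next t hx')
  have hmeas : Measurable fun a => (P (x, a)).real {x'} :=
    ((Kernel.measurable_coe P hx').comp measurable_prodMk_left).ennreal_toReal
  have hD' : MeasurableSet[preHistory Xs As R X' t ⊔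
      MeasurableSpace.comap (As t) inferInstance] D := le_sup_left (α := MeasurableSpace Ω) D hD
  rw [← setIntegral_condExp hm hint hD',
    setIntegral_congr_ae (g := fun ω => (P (x, As t ω)).real {x'}) (hm D hD')
      ((hT.next_law t {x'} hx').mono fun ω h hω => by
        rw [h]; simp only [hDx ω hω]),
    ← integral_map (hT.measurable_action t).aemeasurable hmeas.aestronglyMeasurable
      (f := fun a => (P (x, a)).real {x'}),
    hT.map_action_restrict t hD hDx, integral_smul_measure, policyKernel_real_singleton]
  rfl

/-- On the visits to `x`, the indicator of a move to `x'` has conditional mean the transition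
probability under the policy. -/
lemma condExp_centred (hT : IsTransitionStream μ π P r Xs As R X') (t : ℕ) (x x' : X) :
    μ[(Xs t ⁻¹' {x}).indicator (fun ω => (X' t ⁻¹' {x'}).indicator (fun _ => (1 : ℝ)) ω
        - (policyKernel π P x).real {x'}) | preHistory Xs As R X' t] =ᵐ[μ] 0 := by
  have hm := hT.preHistory_le t
  have hX : MeasurableSet[preHistory Xs As R X' t] (Xs t ⁻¹' {x}) :=
    measurable_state_preHistory t (measurableSet_singleton x)
  have hi : Integrable ((X' t ⁻¹' {x'}).indicator fun _ => (1 : ℝ)) μ :=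
    (integrable_const 1).indicator (hT.measurable_next t (measurableSet_singleton x'))
  refine (ae_eq_condExp_of_forall_setIntegral_eq hm
    ((hi.sub (integrable_const _)).indicator (hm _ hX))
    (fun _ _ _ => integrableOn_zero) (fun D hD _ => ?_)
    stronglyMeasurable_zero.aestronglyMeasurable).symm
  have h := integral_sub (μ := μ.restrict (D ∩ Xs t ⁻¹' {x})) hi.integrableOn
    (integrable_const ((policyKernel π P x).real {x'}))
  rw [setIntegral_indicator (hm _ hX)]
  refine Eq.trans ?_ h.symm
  rw [hT.setIntegral_next t x' (hD.inter hX) fun ω hω => hω.2]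
  simp

end IsTransitionStream

end Transitions

/-! ### Pathwise convergence -/

/-- An asynchronous recursion driven by a sup-norm contraction and by noise whose weighted sums
converge. -/
lemma tendsto_zero_of_contraction_add_noise {X H : Type*} [Fintype X] [DecidableEq X]
    [NormedAddCommGroup H] [NormedSpace ℝ H] {Δ h : ℕ → X → H} {g : X → X → H} {w : X → X → ℝ}
    {a : ℕ → X → ℝ} {ξ : ℕ → X} {β : ℝ} (hβ0 : 0 ≤ β) (hβ1 : β < 1) (ha : ∀ t x, 0 ≤ a t x)
    (hsum : ∀ x, Tendsto (fun n => ∑ t ∈ Finset.range n, a t x) atTop atTop)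
    (hsq : ∀ x, Summable fun t => a t x ^ 2)
    (hrec : ∀ t x, Δ (t + 1) x = (1 - a t x) • Δ t x + a t x • (h t x + g x (ξ t)))
    (hh : ∀ t x M, (∀ x', ‖Δ t x'‖ ≤ M) → ‖h t x‖ ≤ β * M)
    (hg : ∀ x, ∑ x', w x x' • g x x' = 0)
    (hconv : ∀ x x', ∃ l, Tendsto
      (fun n => ∑ t ∈ Finset.range n, a t x * ((if ξ t = x' then 1 else 0) - w x x'))
      atTop (𝓝 l)) (x : X) :
    Tendsto (fun t => ‖Δ t x‖) atTop (𝓝 0) := by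
  choose l hl using hconv
  let S : ℕ → X → H := fun n x => ∑ t ∈ Finset.range n, a t x • g x (ξ t)
  -- `D` is the accumulated noise minus its limit, so it tends to zero while having the same
  -- increments as the noise.
  let D : ℕ → X → H := fun n x => S n x - ∑ x', l x x' • g x x'
  -- Centring by `w` costs nothing, since the `w`-average of `g x` is zero; vector noise thereby
  -- reduces to scalar sums.
  have hS : ∀ n x, S n x = ∑ x', (∑ t ∈ Finset.range n,
      a t x * ((if ξ t = x' then 1 else 0) - w x x')) • g x x' := by
    intro n x
    simp_rw [Finset.sum_smul]
    rw [Finset.sum_comm]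
    refine Finset.sum_congr rfl fun t _ => ?_
    simp_rw [mul_smul, ← Finset.smul_sum, sub_smul, Finset.sum_sub_distrib, hg]
    simp
  have hD : ∀ x, Tendsto (fun n => ‖D n x‖) atTop (𝓝 0) := by
    intro x
    refine tendsto_iff_norm_sub_tendsto_zero.1 ?_
    simp_rw [hS]
    exact tendsto_finsetSum _ fun x' _ => (hl x x').smul_const _
  have ha0 : ∀ x, Tendsto (fun t => a t x) atTop (𝓝 0) := by
    intro x
    have h := (hsq x).tendsto_atTop_zero.sqrt
    simpa [Real.sqrt_sq (ha _ _)] using h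
  have hy := tendsto_zero_of_contractive_recursion (X := X) (y := fun t x => ‖Δ t x - D t x‖)
    (a := a) (e := fun t x => β * ∑ x', ‖D t x'‖ + ‖D t x‖) hβ0 hβ1 (fun t x => norm_nonneg _)
    ha ha0 hsum (fun x => ?_) (fun t x M hM => ?_) x
  · refine squeeze_zero (fun t => norm_nonneg _) (fun t => ?_)
      ((hy.add (hD x)).trans_eq (by rw [add_zero]))
    simpa using norm_add_le (Δ t x - D t x) (D t x)
  · have h1 := (tendsto_finsetSum (Finset.univ : Finset X) fun x' _ => hD x').const_mul β
    simpa using h1.add (hD x)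
  · have hΔ : ∀ x', ‖Δ t x'‖ ≤ M + ∑ x', ‖D t x'‖ := by
      intro x'
      have h1 : ‖Δ t x'‖ ≤ ‖Δ t x' - D t x'‖ + ‖D t x'‖ := by
        simpa using norm_add_le (Δ t x' - D t x') (D t x')
      have h2 : ‖D t x'‖ ≤ ∑ x', ‖D t x'‖ :=
        Finset.single_le_sum (f := fun x' => ‖D t x'‖) (fun _ _ => norm_nonneg _)
          (Finset.mem_univ x')
      linarith [hM x']
    -- The noise cancels exactly; only the small term `D t x` remains as a perturbation.
    have hstep : Δ (t + 1) x - D (t + 1) x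
        = (1 - a t x) • (Δ t x - D t x) + a t x • (h t x - D t x) := by
      simp only [D, S, Finset.sum_range_succ, hrec]
      module
    change ‖Δ (t + 1) x - D (t + 1) x‖ ≤ _
    rw [hstep]
    refine (norm_add_le _ _).trans ?_
    rw [norm_smul, norm_smul, Real.norm_eq_abs, Real.norm_eq_abs, abs_of_nonneg (ha t x)]
    have h3 := mul_le_mul_of_nonneg_left
      ((norm_sub_le (h t x) (D t x)).trans (add_le_add_left (hh t x _ hΔ) _)) (ha t x)
    refine add_le_add_right (h3.trans_eq ?_) _
    ring

/-! ### The projected Bellman operator in coordinates -/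

lemma smul_add_smul_mem_massOneFinsupp {E : Type*} {F : Finset E} {c c' : E →₀ ℝ}
    (hc : c ∈ massOneFinsupp F) (hc' : c' ∈ massOneFinsupp F) (b : ℝ) :
    (1 - b) • c + b • c' ∈ massOneFinsupp F := by
  have h := add_mem_massOneFinsupp hc (Submodule.smul_mem _ b (sub_mem_massZero hc' hc))
  convert h using 1
  module

section Coordinates

variable {X E H : Type*} [AddCommGroup E] [Module ℝ E]
  [NormedAddCommGroup H] [InnerProductSpace ℝ H] {Φ : (E →₀ ℝ) →ₗ[ℝ] H} {C : X → Finset E}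
  {L : X → (E →₀ ℝ) →ₗ[ℝ] (E →₀ ℝ)} {f : X → E} {γ β : ℝ} {r : X → E} {w : X → X → ℝ}

/-- Writing `c = δ + v`, with `δ` a reference point of unit masses and `v` of mass zero, turns the
affine fixed-point equation into `v = u + T v`. Here `u` is the defect of `δ` and `T`, a projected
average of backups, contracts by `β`. -/
lemma existsUnique_affineProj_fixedPoint [Fintype X] (hinj : ∀ c, mass c = 0 → Φ c = 0 → c = 0)
    (hL : ∀ x, IsMassZeroProj Φ (C x) (L x)) (hf : ∀ x, f x ∈ C x) (hβ1 : β < 1)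
    (hβ : ∀ (y : E) (v : E →₀ ℝ), mass v = 0 → ‖Φ (v.mapDomain (boot γ y))‖ = β * ‖Φ v‖)
    (hβ0 : 0 ≤ β) (hw0 : ∀ x x', 0 ≤ w x x') (hw1 : ∀ x, ∑ x', w x x' = 1) :
    ∃! c : X → E →₀ ℝ, (∀ x, c x ∈ massOneFinsupp (C x)) ∧
      ∀ x, affineProj (L x) (f x) (∑ x', w x x' • (c x').mapDomain (boot γ (r x))) = c x := by
  let T : (X → E →₀ ℝ) →ₗ[ℝ] (X → E →₀ ℝ) := LinearMap.pi fun x =>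
    L x ∘ₗ ∑ x', w x x' • (Finsupp.lmapDomain ℝ ℝ (boot γ (r x)) ∘ₗ LinearMap.proj x')
  have hTa : ∀ v x, T v x = L x (∑ x', w x x' • (v x').mapDomain (boot γ (r x))) := by
    intro v x
    simp [T]
  let δ : X → E →₀ ℝ := fun x => Finsupp.single (f x) 1
  let u : X → E →₀ ℝ := fun x =>
    affineProj (L x) (f x) (∑ x', w x x' • (δ x').mapDomain (boot γ (r x))) - δ x
  have hδ : ∀ x, δ x ∈ massOneFinsupp (C x) := fun x => single_mem_massOneFinsupp (hf x)
  have hcontr : ∀ v : X → E →₀ ℝ, (∀ x, v x ∈ massZero (C x)) → ∀ M, (∀ x, ‖Φ (v x)‖ ≤ M) →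
      ∀ x, ‖Φ (T v x)‖ ≤ β * M := by
    intro v hv M hM x
    rw [hTa]
    refine ((hL x).norm_le _).trans ?_
    rw [map_sum]
    refine (norm_sum_le _ _).trans ?_
    calc ∑ x', ‖Φ (w x x' • (v x').mapDomain (boot γ (r x)))‖
        ≤ ∑ x', w x x' * (β * M) := by
          refine Finset.sum_le_sum fun x' _ => ?_
          rw [map_smul, norm_smul, Real.norm_of_nonneg (hw0 x x'),
            hβ _ _ (mem_massZero.1 (hv x')).2]
          have := hw0 x x'
          gcongr
          exact hM x'
      _ = β * M := by rw [← Finset.sum_mul, hw1, one_mul]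
  obtain ⟨v, ⟨hv, hveq⟩, hvu⟩ := existsUnique_eq_add_of_contraction Φ (fun x => massZero (C x))
    (fun x v hv => hinj v (mem_massZero.1 hv).2) T (fun v x => by rw [hTa]; exact (hL x).mem _)
    hβ1 hcontr u
    (fun x => sub_mem_massZero (affineProj_mem (hL x) (hf x) _) (hδ x))
  have key : ∀ v : X → E →₀ ℝ, v = u + T v ↔ ∀ x, affineProj (L x) (f x)
      (∑ x', w x x' • (δ x' + v x').mapDomain (boot γ (r x))) = δ x + v x := by
    intro v
    rw [funext_iff]
    refine forall_congr' fun x => ?_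
    have h := affineProj_sub (L := L x) (f := f x)
      (∑ x', w x x' • (δ x' + v x').mapDomain (boot γ (r x)))
      (∑ x', w x x' • (δ x').mapDomain (boot γ (r x)))
    rw [← Finset.sum_sub_distrib] at h
    simp_rw [← smul_sub, Finsupp.mapDomain_add, add_sub_cancel_left] at h
    rw [← hTa, sub_eq_iff_eq_add] at h
    simp_rw [Finsupp.mapDomain_add]
    rw [h, Pi.add_apply]
    constructor
    · intro h'
      conv_rhs => rw [h']
      simp only [u]
      abel
    · intro h'
      rw [← sub_eq_iff_eq_add'] at h'
      conv_lhs => rw [← h']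
      simp only [u]
      abel
  refine ⟨δ + v, ⟨fun x => add_mem_massOneFinsupp (hδ x) (hv x), (key v).1 hveq⟩, ?_⟩
  rintro c ⟨hc, hceq⟩
  have h := hvu (c - δ) ⟨fun x => sub_mem_massZero (hc x) (hδ x), (key _).2 fun x => ?_⟩
  · rw [← h, add_sub_cancel]
  · simpa using hceq x

variable [MeasurableSpace E]

lemma bellman_atomic [Fintype X] {A : Type*} [MeasurableSpace X] [MeasurableSpace A]
    (hb : ∀ y : E, Measurable (boot γ y)) (π : Kernel X A) (P : Kernel (X × A) X)
    (c : X → E →₀ ℝ) (x : X) :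
    bellman π P r γ (fun x => atomic (c x)) x
      = atomic (∑ x', (policyKernel π P x).real {x'} • (c x').mapDomain (boot γ (r x))) := by
  simp only [bellman, map_sum, map_smul, atomic_map _ (hb _)]

variable [MeasurableSingletonClass E] {κ : E → E → ℝ}

/-- Here `a` is the global step size and `b` the one felt at `x`, zero unless `x` is visited. At an
unvisited state the projection fixes the current value, so the update is trivial there. -/
lemma td_step_atomic (hΦ : ∀ c c', inner ℝ (Φ c) (Φ c') = bilin κ c c')
    (hinj : ∀ c, mass c = 0 → Φ c = 0 → c = 0)
    (hL : ∀ x, IsMassZeroProj Φ (C x) (L x)) (hf : ∀ x, f x ∈ C x)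
    (hb : ∀ y : E, Measurable (boot γ y)) {c : X → E →₀ ℝ}
    (hc : ∀ x, c x ∈ massOneFinsupp (C x)) (x₀ x' : X) (a b : ℝ) (x : X)
    (hab : x = x₀ → b = a) (hb0 : x ≠ x₀ → b = 0) :
    ((1 - a) • (fun x => atomic (c x)) + a • signedCatProj κ C
        (stochBellman γ x₀ (r x₀) x' (fun x => atomic (c x)))) x
      = atomic ((1 - b) • c x
          + b • affineProj (L x) (f x) ((c x').mapDomain (boot γ (r x)))) := by
  simp only [Pi.add_apply, Pi.smul_apply, signedCatProj, stochBellman]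
  split_ifs with h
  · subst h
    rw [atomic_map _ (hb _), signedProj_atomic hΦ hinj (hL x) (hf x), hab rfl, map_add, map_smul,
      map_smul]
  · rw [signedProj_atomic hΦ hinj (hL x) (hf x), affineProj_of_mem (hL x) hinj (hf x) (hc x),
      hb0 h, sub_zero, one_smul, zero_smul, add_zero, ← add_smul, sub_add_cancel, one_smul]

/-- Coordinates of the categorical TD iterates. -/
lemma exists_td_coordinates (hΦ : ∀ c c', inner ℝ (Φ c) (Φ c') = bilin κ c c')
    (hinj : ∀ c, mass c = 0 → Φ c = 0 → c = 0)
    (hL : ∀ x, IsMassZeroProj Φ (C x) (L x)) (hf : ∀ x, f x ∈ C x)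
    (hb : ∀ y : E, Measurable (boot γ y)) {η₀ : X → SignedMeasure E} (hη₀ : η₀ ∈ signedCatClass C)
    (α : ℕ → ℝ) (Xs : ℕ → X) (X' : ℕ → X) :
    ∃ c : ℕ → X → E →₀ ℝ, (∀ t x, c t x ∈ massOneFinsupp (C x)) ∧
      (∀ t, tdIterates κ C γ η₀ α Xs (fun s => r (Xs s)) X' t = fun x => atomic (c t x)) ∧
      ∀ t x, c (t + 1) x = (1 - {s | Xs s = x}.indicator α t) • c t x
        + {s | Xs s = x}.indicator α t •
          affineProj (L x) (f x) ((c t (X' t)).mapDomain (boot γ (r x))) := by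
  choose c₀ hc₀ hc₀' using fun x => exists_atomic_eq (hη₀ x)
  let c : ℕ → X → E →₀ ℝ := fun t => Nat.rec c₀ (fun t c x =>
    (1 - {s | Xs s = x}.indicator α t) • c x + {s | Xs s = x}.indicator α t •
      affineProj (L x) (f x) ((c (X' t)).mapDomain (boot γ (r x)))) t
  have hc : ∀ t x, c t x ∈ massOneFinsupp (C x) := by
    intro t
    induction t with
    | zero => exact hc₀
    | succ t ih =>
      exact fun x => smul_add_smul_mem_massOneFinsupp (ih x) (affineProj_mem (hL x) (hf x) _) _
  refine ⟨c, hc, fun t => ?_, fun t x => rfl⟩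
  induction t with
  | zero => exact funext fun x => (hc₀' x).symm
  | succ t ih =>
    rw [tdIterates, ih]
    refine funext fun x => td_step_atomic hΦ hinj hL hf hb (hc t) _ _ _ _ x (fun h => ?_)
      (fun h => ?_)
    · exact Set.indicator_of_mem (s := {s | Xs s = x}) h.symm α
    · exact Set.indicator_of_notMem (s := {s | Xs s = x}) (fun h' => h h'.symm) α

end Coordinates

/-- Almost surely, the weighted sums of centred transition indicators converge. -/
lemma IsTransitionStream.ae_exists_tendsto_sum {Ω X A E : Type*} [MeasurableSpace Ω]
    [MeasurableSpace X] [MeasurableSpace A] [MeasurableSpace E] [Finite X] [DecidableEq X]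
    [MeasurableSingletonClass X] {μ : Measure Ω} [IsProbabilityMeasure μ] {π : Kernel X A}
    [IsMarkovKernel π] {P : Kernel (X × A) X} [IsMarkovKernel P] {r : X → E} {Xs : ℕ → Ω → X}
    {As : ℕ → Ω → A} {R : ℕ → Ω → E} {X' : ℕ → Ω → X}
    (hT : IsTransitionStream μ π P r Xs As R X') {α : ℕ → Ω → ℝ}
    (hα : ∀ t, Measurable[preHistory Xs As R X' t] (α t))
    (hRM : ∀ᵐ ω ∂μ, RobbinsMonro (fun t => α t ω) (fun t => Xs t ω)) (x x' : X) :
    ∀ᵐ ω ∂μ, ∃ l, Tendsto (fun n => ∑ t ∈ Finset.range n,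
      {s | Xs s ω = x}.indicator (fun s => α s ω) t *
        ((if X' t ω = x' then 1 else 0) - (policyKernel π P x).real {x'})) atTop (𝓝 l) := by
  have hP : IsProbabilityMeasure (policyKernel π P x) := by
    unfold policyKernel
    infer_instance
  have hX : ∀ t, MeasurableSet[hT.filtration t] (Xs t ⁻¹' {x}) := fun t =>
    measurable_state_preHistory t (measurableSet_singleton x)
  have key := ae_exists_tendsto_sum_of_summable_sq hT.filtration
    (a := fun t => (Xs t ⁻¹' {x}).indicator (α t))
    (fun t => (hα t).stronglyMeasurable.indicator (hX t))
    (fun t => ((stronglyMeasurable_const.indicator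
      (measurable_next_preHistory t (measurableSet_singleton x'))).sub
        stronglyMeasurable_const).indicator (hT.filtration.mono t.le_succ _ (hX t)))
    (fun t ω => ?_) (fun t => hT.condExp_centred t x x') ?_
  · filter_upwards [key] with ω ⟨l, hl⟩
    refine ⟨l, hl.congr fun n => Finset.sum_congr rfl fun t _ => ?_⟩
    by_cases h : Xs t ω = x <;> by_cases h' : X' t ω = x' <;> simp [h, h']
  · have h0 : 0 ≤ (policyKernel π P x).real {x'} := measureReal_nonneg
    have h1 : (policyKernel π P x).real {x'} ≤ 1 := measureReal_le_one
    by_cases h : Xs t ω = x <;> by_cases h' : X' t ω = x' <;>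
      
      simp only [Pi.sub_apply, Set.indicator, Set.mem_preimage, Set.mem_singleton_iff, h, h', if_true, if_false,
        abs_le] <;> constructor <;> linarith
  · filter_upwards [hRM] with ω hω
    refine (hω x).2.congr fun t => ?_
    by_cases h : Xs t ω = x <;> simp [h]

/-- Mass one cannot be carried by the empty set; nonemptiness of each `C x` is thus implied by the
initial iterate. -/
lemma nonempty_of_mem_massOne {Y : Type*} [MeasurableSpace Y] {F : Finset Y} {p : SignedMeasure Y}
    (hp : p ∈ massOne (F : Set Y)) : F.Nonempty := by
  by_contra h
  rw [Finset.not_nonempty_iff_eq_empty] at h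
  subst h
  have := hp.2 Set.univ MeasurableSet.univ (by simp)
  rw [hp.1] at this
  exact one_ne_zero this

/-- Affine maps commute with combinations of total weight one. This is why the noise of the sampled
projected backup is centred. -/
lemma affineProj_weighted_sum_sub {X Y : Type*} [Fintype X] {L : (Y →₀ ℝ) →ₗ[ℝ] (Y →₀ ℝ)} {f : Y}
    {w : X → ℝ} (hw : ∑ x, w x = 1) {u : X → Y →₀ ℝ} {z : Y →₀ ℝ} :
    affineProj L f (∑ x, w x • u x) - z = ∑ x, w x • (affineProj L f (u x) - z) := by
  simp only [affineProj, smul_sub, smul_add, Finset.sum_sub_distrib, Finset.sum_add_distrib,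
    ← Finset.sum_smul, hw, one_smul, map_sub, map_sum, map_smul]

end CatTD

/-- Almost sure convergence of signed categorical temporal-difference learning. -/
theorem mainTheorem1
    -- the Markov decision process, with finite state space, and the policy
    {X : Type*} [Fintype X] [MeasurableSpace X] [MeasurableSingletonClass X]
    {A : Type*} [MeasurableSpace A] {d : ℕ}
    (π : Kernel X A) [IsMarkovKernel π]
    (P : Kernel (X × A) X) [IsMarkovKernel P]
    (r : X → EuclideanSpace ℝ (Fin d))
    (γ : ℝ) (hγ0 : 0 ≤ γ) (hγ1 : γ < 1)
    -- the kernel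
    (ρ : EuclideanSpace ℝ (Fin d) → EuclideanSpace ℝ (Fin d) → ℝ)
    (hρ : IsSemimetric ρ) (hneg : StrongNegativeType ρ)
    (hshift : ShiftInvariant ρ) (hhom : Homogeneous ρ)
    (y₀ : EuclideanSpace ℝ (Fin d))
    -- the support map and the initial iterate
    (C : X → Finset (EuclideanSpace ℝ (Fin d)))
    (η₀ : X → SignedMeasure (EuclideanSpace ℝ (Fin d))) (hη₀ : η₀ ∈ signedCatClass C)
    -- the stream of transitions
    {Ω : Type*} [MeasurableSpace Ω] (μ : Measure Ω) [IsProbabilityMeasure μ]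
    (Xs : ℕ → Ω → X) (As : ℕ → Ω → A) (R : ℕ → Ω → EuclideanSpace ℝ (Fin d)) (X' : ℕ → Ω → X)
    (hT : IsTransitionStream μ π P r Xs As R X')
    -- the step sizes
    (α : ℕ → Ω → ℝ) (hα0 : ∀ t ω, 0 ≤ α t ω)
    (hαmeas : ∀ t, Measurable[preHistory Xs As R X' t] (α t))
    (hRM : ∀ᵐ ω ∂μ, RobbinsMonro (fun t => α t ω) (fun t => Xs t ω)) :
    -- the projection is well defined on finitely supported signed measures of mass one
    (∀ (x : X) (F : Finset (EuclideanSpace ℝ (Fin d))), ∀ q ∈ massOne (F : Set _),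
      ∃! p, IsSignedProj (inducedKernel ρ y₀) (C x : Set _) q p) ∧
    -- the projected Bellman operator has a unique fixed point, and the iterates converge to it
    ∃ ηSC : X → SignedMeasure (EuclideanSpace ℝ (Fin d)),
      (ηSC ∈ signedCatClass C ∧
        signedCatProj (inducedKernel ρ y₀) C (bellman π P r γ ηSC) = ηSC) ∧
      (∀ η ∈ signedCatClass C,
        signedCatProj (inducedKernel ρ y₀) C (bellman π P r γ η) = η → η = ηSC) ∧
      ∀ᵐ ω ∂μ, Tendsto
        (fun t => supMMD (inducedKernel ρ y₀)
          (tdIterates (inducedKernel ρ y₀) C γ η₀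
            (fun s => α s ω) (fun s => Xs s ω) (fun s => R s ω) (fun s => X' s ω) t)
          ηSC)
        atTop (𝓝 0) := by
  classical
  have h0 : ∀ y, ρ y y = 0 := fun y => (hρ.eq_zero_iff y y).2 rfl
  have hnegc : ∀ c : EuclideanSpace ℝ (Fin d) →₀ ℝ, mass c = 0 → c ≠ 0 → bilin ρ c c < 0 :=
    fun c => bilin_neg_of_strongNegativeType hneg
  obtain ⟨H, _, _, Φ, hΦ⟩ := exists_meanEmbedding h0 hρ.symm hnegc y₀
  have hinj : ∀ c, mass c = 0 → Φ c = 0 → c = 0 := fun c =>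
    meanEmbedding_eq_zero h0 hρ.symm hnegc hΦ
  have hne : ∀ x, (C x).Nonempty := fun x => nonempty_of_mem_massOne (hη₀ x)
  choose f hf using hne
  choose L hL using fun x => exists_isMassZeroProj hinj (C x)
  obtain ⟨k, hk0, hk⟩ := hhom γ hγ0 hγ1
  have hk0' : 0 ≤ γ ^ k := Real.rpow_nonneg hγ0 k
  have hβ1 : √(γ ^ k) < 1 := by
    rw [Real.sqrt_lt' one_pos, one_pow]
    exact Real.rpow_lt_one hγ0 hγ1 hk0
  have hβ := fun y v => norm_meanEmbedding_mapDomain_boot h0 hρ.symm hshift hk0' hk hΦ y (v := v)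
  have hb : ∀ y : EuclideanSpace ℝ (Fin d), Measurable (boot γ y) := fun y => by
    unfold boot
    fun_prop
  have hP : ∀ x, IsProbabilityMeasure (policyKernel π P x) := fun x => by
    unfold policyKernel
    infer_instance
  obtain ⟨c, ⟨hc, hceq⟩, hcu⟩ := existsUnique_affineProj_fixedPoint (r := r)
    (w := fun x x' => (policyKernel π P x).real {x'}) hinj hL hf hβ1 hβ (Real.sqrt_nonneg _)
    (fun _ _ => measureReal_nonneg) (fun x => by simp)
  have hproj : ∀ c' : X → EuclideanSpace ℝ (Fin d) →₀ ℝ,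
      signedCatProj (inducedKernel ρ y₀) C (bellman π P r γ fun x => atomic (c' x))
        = fun x => atomic (affineProj (L x) (f x)
          (∑ x', (policyKernel π P x).real {x'} • (c' x').mapDomain (boot γ (r x)))) := by
    intro c'
    funext x
    rw [signedCatProj, bellman_atomic hb, signedProj_atomic hΦ hinj (hL x) (hf x)]
  refine ⟨fun x F q hq => ?_, fun x => atomic (c x),
    ⟨fun x => (atomic_mem_massOne_iff _ _).2 (hc x), ?_⟩, fun η hη hηeq => ?_, ?_⟩
  · obtain ⟨c', -, rfl⟩ := exists_atomic_eq hq
    have h := isSignedProj_atomic_iff hΦ hinj (hL x) (hf x) c'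
    exact ⟨_, (h _).2 rfl, fun p hp => (h p).1 hp⟩
  · rw [hproj]
    exact funext fun x => congrArg atomic (hceq x)
  · choose c' hc' hc'' using fun x => exists_atomic_eq (hη x)
    obtain rfl : η = fun x => atomic (c' x) := funext fun x => (hc'' x).symm
    rw [hproj] at hηeq
    rw [hcu c' ⟨hc', fun x => atomic_injective (congrFun hηeq x)⟩]
  · filter_upwards [hRM, ae_all_iff.2 fun x => ae_all_iff.2 fun x' =>
      hT.ae_exists_tendsto_sum hαmeas hRM x x'] with ω hω hconv
    obtain ⟨θ, hθ, hθeq, hθrec⟩ := exists_td_coordinates (r := r) hΦ hinj hL hf hb hη₀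
      (fun s => α s ω) (fun s => Xs s ω) (fun s => X' s ω)
    simp_rw [hT.reward_eq, hθeq]
    have hlim : ∀ x, Tendsto (fun t => ‖Φ (θ t x - c x)‖) atTop (𝓝 0) := by
      -- The term `h` compares iterate and fixed point under the same sampled backup; the term `g`
      -- is the sampling error at the fixed point alone.
      refine tendsto_zero_of_contraction_add_noise (ξ := fun t => X' t ω)
        (Δ := fun t x => Φ (θ t x - c x))
        (h := fun t x => Φ (affineProj (L x) (f x) ((θ t (X' t ω)).mapDomain (boot γ (r x)))
          - affineProj (L x) (f x) ((c (X' t ω)).mapDomain (boot γ (r x)))))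
        (g := fun x x' =>
          Φ (affineProj (L x) (f x) ((c x').mapDomain (boot γ (r x))) - c x))
        (w := fun x x' => (policyKernel π P x).real {x'})
        (a := fun t x => {s | Xs s ω = x}.indicator (fun s => α s ω) t)
        (Real.sqrt_nonneg _) hβ1
        (fun t x => Set.indicator_nonneg (fun s _ => hα0 s ω) t) (fun x => (hω x).1)
        (fun x => (hω x).2.congr fun t => ?_) (fun t x => ?_) (fun t x M hM => ?_)
        (fun x => ?_) hconv
      · by_cases h : Xs t ω = x <;> simp [h]
      · rw [hθrec, ← map_add, ← map_smul, ← map_smul, ← map_add]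
        congr 1
        module
      · have hm : mass (θ t (X' t ω) - c (X' t ω)) = 0 :=
          (mem_massZero.1 (sub_mem_massZero (hθ t _) (hc _))).2
        rw [affineProj_sub, ← Finsupp.mapDomain_sub]
        refine ((hL x).norm_le _).trans ?_
        rw [hβ _ _ hm]
        exact mul_le_mul_of_nonneg_left (hM _) (Real.sqrt_nonneg _)
      · simp_rw [← map_smul, ← map_sum]
        rw [← affineProj_weighted_sum_sub (by simp), hceq, sub_self, map_zero]
    have hlim' := tendsto_finsetSum (Finset.univ : Finset X) fun x _ => hlim x
    rw [Finset.sum_const_zero] at hlim'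
    -- The supremum is dominated by the finite sum over states, which also covers an empty state
    -- space, where the real supremum is zero.
    refine squeeze_zero (fun t => Real.iSup_nonneg fun x => Real.sqrt_nonneg _) (fun t => ?_) hlim'
    refine Real.iSup_le (fun x => ?_) (Finset.sum_nonneg fun x _ => norm_nonneg _)
    rw [mmd_atomic hΦ]
    exact Finset.single_le_sum (f := fun x => ‖Φ (θ t x - c x)‖) (fun _ _ => norm_nonneg _)
      (Finset.mem_univ x)
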